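/- Let $d\ge1$ and let $d\gamma=\gamma(x)\,dx$, $\gamma(x)=(2\pi)^{-d/2}e^{-|x|^2/2}$, be the normalized Gaussian probability measure on $\mathbb R^d$. Let $\mathrm H^1(\mathbb R^d,d\gamma)$ be the space of real-valued functions $v\in\mathrm L^2(\mathbb R^d,d\gamma)$ whose weak gradient $\nabla v$ belongs to $\mathrm L^2(\mathbb R^d,d\gamma)$, and define $$\varphi(t):=\frac d4\left[\exp\left(\frac{2t}d\right)-1-\frac{2t}d\right]\qquad\forall\,t\in\mathbb R.$$ Then for any $v\in\mathrm H^1(\mathbb R^d,d\gamma)$ such that $\int_{\mathbb R^d}|v|^2\,d\gamma=1$ and $\int_{\mathbb R^d}|x|^2\,|v|^2\,d\gamma<\infty$, the function $|v|^2\log|v|^2$ (with the convention $0\log0=0$) is integrable with respect to $\gamma$ and $$\int_{\mathbb R^d}|\nabla v|^2\,d\gamma-\frac12\int_{\mathbb R^d}|v|^2\log|v|^2\,d\gamma\ \ge\ \varphi\left(\int_{\mathbb R^d}|v|^2\log|v|^2\,d\gamma+\frac d2-\frac12\int_{\mathbb R^d}|x|^2\,|v|^2\,d\gamma\right).$$ 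-/

import Mathlib

open MeasureTheory
open scoped ContDiff

noncomputable section

/-- The density `γ(x) = (2π)^{-d/2} exp(-|x|²/2)` of the normalized Gaussian on `ℝᵈ`. -/
def gaussianDensity (d : ℕ) (x : EuclideanSpace ℝ (Fin d)) : ℝ :=
  (2 * Real.pi) ^ (-(d : ℝ) / 2) * Real.exp (-‖x‖ ^ 2 / 2)

/-- The normalized Gaussian probability measure `dγ = γ(x) dx` on `ℝᵈ`. -/
def gaussianMeasure (d : ℕ) : Measure (EuclideanSpace ℝ (Fin d)) :=
  (volume : Measure (EuclideanSpace ℝ (Fin d))).withDensity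
    fun x => ENNReal.ofReal (gaussianDensity d x)

/-- `G` is the weak (distributional) gradient of `v` on `ℝᵈ`: both are locally integrable with
respect to Lebesgue measure and `∫ v ∂ᵢψ dx = - ∫ Gᵢ ψ dx` for every coordinate `i` and
every smooth compactly supported test function `ψ`. -/
structure IsWeakGradient {d : ℕ} (v : EuclideanSpace ℝ (Fin d) → ℝ)
    (G : EuclideanSpace ℝ (Fin d) → EuclideanSpace ℝ (Fin d)) : Prop where
  locallyIntegrable : LocallyIntegrable v volume
  locallyIntegrable_grad : LocallyIntegrable G volume
  integral_eq : ∀ ψ : EuclideanSpace ℝ (Fin d) → ℝ, ContDiff ℝ ∞ ψ → HasCompactSupport ψ →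
    ∀ i : Fin d,
      ∫ x, v x * fderiv ℝ ψ x (EuclideanSpace.single i 1) = - ∫ x, G x i * ψ x

/-- `v` belongs to the Gaussian Sobolev space `H¹(ℝᵈ, dγ)`, with `∇v = G`. The
gradient `G` is determined by `v` up to a null set. -/
structure IsGaussianH1 {d : ℕ} (v : EuclideanSpace ℝ (Fin d) → ℝ)
    (G : EuclideanSpace ℝ (Fin d) → EuclideanSpace ℝ (Fin d)) : Prop where
  memLp : MemLp v 2 (gaussianMeasure d)
  memLp_grad : MemLp G 2 (gaussianMeasure d)
  isWeakGradient : IsWeakGradient v G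

/-- `φ(t) = (d/4) [exp(2t/d) - 1 - 2t/d]`. -/
def deficitProfile (d : ℕ) (t : ℝ) : ℝ :=
  (d : ℝ) / 4 * (Real.exp (2 * t / d) - 1 - 2 * t / d)

end

/-! The inequality is the sharp Euclidean logarithmic Sobolev inequality read through `u = √γ v`. If
`∫ u² = 1`, then for every `b > 0`, `∫ u² log u² ≤ b² ∫ |∇u|² - d (1 + log b + (log π)/2)`. Write `I
= ∫ |∇v|² dγ`, `M = ∫ |x|² v² dγ` and `Ent = ∫ v² log v² dγ`. Since `∫ u x·∇u = -d/2`, the Fisher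
information `J = ∫ |∇u|²` equals `I + d/2 - M/4`, while `Ent = ∫ u² log u² + (d/2) log (2π) + M/2`.
With `t = Ent + d/2 - M/2` and `b = √2 exp(-t/d)`, the Euclidean inequality becomes `J ≥ (d/4)
exp(2t/d)`. As `I - Ent/2 = J - d/4 - t/2`, this is the claim (`deficit_le_of_bound`).

The Euclidean inequality is proved in dimension one by monotone transport `T` of a density `f` to a
multiple of `exp(-y²)` on `[-L, L]`: take the logarithm of `T' = Z f exp(T²)`, use `log (b T') ≤ b
T' - 1`, integrate by parts, absorb the result by the arithmetic-geometric mean inequality, and let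
`L → ∞` (`entropy_le_of_transport`). It tensorizes by induction on `d` (`entropy_le_pi`): apply it
to the slices and then to the marginal, whose Fisher information is controlled by Cauchy-Schwarz.
Fisher information enters as a function `h` with `f'² ≤ 4 f h`, which avoids division by `f` and
survives taking marginals.

Cutoff and mollification extend the result to weakly differentiable `u`
(`IsWeakGradient.relative_entropy_le`). The quadratic terms converge; the relative entropy is
handled by Fatou's lemma, which also gives its integrability. -/

open Filter Topology Set
open scoped Convolution ENNReal

/-! ### Monotone transport on the line. -/

/-- The continuous positive density `exp(-y²)`, frozen to the constant `exp(-L²)` outside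
`[-L, L]`. -/
noncomputable def truncGauss (L y : ℝ) : ℝ := max (Real.exp (-y ^ 2)) (Real.exp (-L ^ 2))

theorem continuous_truncGauss (L : ℝ) : Continuous (truncGauss L) := by
  unfold truncGauss; fun_prop

theorem truncGauss_pos (L y : ℝ) : 0 < truncGauss L y :=
  lt_max_of_lt_left (Real.exp_pos _)

theorem truncGauss_eq {L y : ℝ} (h : y ∈ Icc (-L) L) : truncGauss L y = Real.exp (-y ^ 2) := by
  refine max_eq_left (Real.exp_le_exp.2 ?_)
  nlinarith [h.1, h.2]

/-- The primitive of `truncGauss L` is invertible with differentiable inverse. -/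
theorem exists_inverse_primitive_truncGauss (L : ℝ) :
    ∃ Ψ : ℝ → ℝ, StrictMono Ψ ∧ (∀ y, Ψ (∫ t in (0 : ℝ)..y, truncGauss L t) = y) ∧
      ∀ s, HasDerivAt Ψ (truncGauss L (Ψ s))⁻¹ s := by
  have hc := continuous_truncGauss L
  set Φ : ℝ → ℝ := fun y => ∫ t in (0 : ℝ)..y, truncGauss L t with hΦ
  have hd : ∀ y, HasDerivAt Φ (truncGauss L y) y := fun y =>
    intervalIntegral.integral_hasDerivAt_right (hc.intervalIntegrable _ _)
      (hc.stronglyMeasurableAtFilter _ _) hc.continuousAt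
  have hcont : Continuous Φ := continuous_iff_continuousAt.2 fun y => (hd y).continuousAt
  have hmono : StrictMono Φ := strictMono_of_hasDerivAt_pos hd (fun y => truncGauss_pos L y)
  -- Freezing the density at `exp(-L²)` keeps the slope of the primitive bounded below, so that it
  -- maps onto all of `ℝ`.
  have hint : ∀ a b : ℝ, a ≤ b → Real.exp (-L ^ 2) * (b - a) ≤ Φ b - Φ a := by
    intro a b hab
    have h1 : Φ b - Φ a = ∫ t in a..b, truncGauss L t :=
      intervalIntegral.integral_interval_sub_left (hc.intervalIntegrable _ _)
        (hc.intervalIntegrable _ _)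
    rw [h1]
    have h2 := intervalIntegral.integral_mono_on hab
      (continuous_const.intervalIntegrable (μ := volume) a b : IntervalIntegrable
        (fun _ => Real.exp (-L ^ 2)) volume a b)
      (hc.intervalIntegrable a b) (fun t _ => le_max_right _ _)
    simp only [intervalIntegral.integral_const, smul_eq_mul] at h2
    linarith [mul_comm (b - a) (Real.exp (-L ^ 2))]
  have h0 : Φ 0 = 0 := by simp [hΦ]
  have he : 0 < Real.exp (-L ^ 2) := Real.exp_pos _
  have htop : Tendsto Φ atTop atTop := by
    refine tendsto_atTop_mono' _ ?_ (tendsto_id.const_mul_atTop he)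
    filter_upwards [eventually_ge_atTop 0] with y hy
    have := hint 0 y hy
    simp only [h0, id] at *; linarith
  have hbot : Tendsto Φ atBot atBot := by
    refine tendsto_atBot_mono' _ ?_ (tendsto_id.const_mul_atBot he)
    filter_upwards [eventually_le_atBot 0] with y hy
    have := hint y 0 hy
    simp only [h0, id] at *; linarith
  have hsurj : Function.Surjective Φ := hcont.surjective htop hbot
  let e : ℝ ≃o ℝ := hmono.orderIsoOfSurjective Φ hsurj
  have hee : ∀ y, e y = Φ y := fun y => rfl
  refine ⟨e.symm, e.symm.strictMono, fun y => e.symm_apply_apply y, fun s => ?_⟩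
  refine HasDerivAt.of_local_left_inverse (f := Φ) e.symm.continuous.continuousAt (hd _)
    (truncGauss_pos _ _).ne' (Eventually.of_forall fun t => ?_)
  rw [← hee, e.apply_symm_apply]

/-- Monotone transport of a probability density to the Gaussian `exp(-y²)` restricted to
`[-L, L]`. -/
theorem exists_transport {f : ℝ → ℝ} (hf : Continuous f) (hfi : Integrable f) (h0 : ∀ x, 0 ≤ f x)
    (h1 : ∫ x, f x = 1) {L : ℝ} (hL : 0 < L) :
    ∃ T : ℝ → ℝ,
      ∀ x, HasDerivAt T ((∫ y in (-L)..L, Real.exp (-y ^ 2)) * f x * Real.exp (T x ^ 2)) x := by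
  obtain ⟨Ψ, hmono, hinv, hder⟩ := exists_inverse_primitive_truncGauss L
  have hc := continuous_truncGauss L
  set Φ : ℝ → ℝ := fun y => ∫ t in (0 : ℝ)..y, truncGauss L t with hΦ
  set Z := ∫ y in (-L)..L, Real.exp (-y ^ 2) with hZ
  have hZΦ : Φ L - Φ (-L) = Z := by
    rw [hΦ, hZ]
    simp only
    rw [intervalIntegral.integral_interval_sub_left (hc.intervalIntegrable _ _)
        (hc.intervalIntegrable _ _)]
    refine intervalIntegral.integral_congr fun y hy => ?_
    rw [uIcc_of_le (by linarith)] at hy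
    exact truncGauss_eq hy
  have hZ0 : 0 ≤ Z := intervalIntegral.integral_nonneg (by linarith) fun y _ => (Real.exp_pos _).le
  have hF : ∀ x, HasDerivAt (fun x => ∫ t in Iic x, f t) (f x) x := by
    intro x
    have h2 : (fun x => ∫ t in Iic x, f t) = fun x => (∫ t in Iic 0, f t) + ∫ t in (0:ℝ)..x, f t := by
      ext x
      rw [← intervalIntegral.integral_Iic_sub_Iic hfi.integrableOn hfi.integrableOn]; ring
    rw [h2]
    exact (intervalIntegral.integral_hasDerivAt_right (hf.intervalIntegrable _ _)
      (hf.stronglyMeasurableAtFilter _ _) hf.continuousAt).const_add _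
  have hF0 : ∀ x, 0 ≤ ∫ t in Iic x, f t := fun x => integral_nonneg h0
  have hF1 : ∀ x, ∫ t in Iic x, f t ≤ 1 := fun x =>
    h1 ▸ setIntegral_le_integral hfi (Eventually.of_forall h0)
  -- The transport stays in `[-L, L]`, where the frozen density is still the Gaussian; hence its
  -- derivative carries the factor `exp(T²)`.
  have hmem : ∀ x, Ψ (Φ (-L) + Z * ∫ t in Iic x, f t) ∈ Icc (-L) L := by
    intro x
    constructor
    · rw [← hinv (-L)]
      refine hmono.monotone ?_
      rw [hinv]
      have := mul_nonneg hZ0 (hF0 x)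
      show Φ (-L) ≤ _
      linarith
    · conv_rhs => rw [← hinv L]
      refine hmono.monotone ?_
      show _ ≤ Φ L
      nlinarith [hF1 x]
  refine ⟨fun x => Ψ (Φ (-L) + Z * ∫ t in Iic x, f t), fun x => ?_⟩
  have h3 := (hder (Φ (-L) + Z * ∫ t in Iic x, f t)).comp x (((hF x).const_mul Z).const_add (Φ (-L)))
  rw [truncGauss_eq (hmem x)] at h3
  refine h3.congr_deriv ?_
  rw [← Real.exp_neg, neg_neg, mul_comm]

/-! ### The one-dimensional logarithmic Sobolev inequality. -/

/-- Truncating the target to `[-L, L]` makes `T` differentiable on all of `ℝ`, even where `f`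
vanishes, so the integration by parts has no boundary terms. -/
theorem entropy_le_of_transport {f g h : ℝ → ℝ} (hcs : HasCompactSupport f)
    (h0 : ∀ x, 0 ≤ f x) (hd : ∀ x, HasDerivAt f (g x) x) (hg : Continuous g)
    (hh : Continuous h) (hhs : HasCompactSupport h) (hh0 : ∀ x, 0 ≤ h x)
    (hfgh : ∀ x, g x ^ 2 ≤ 4 * f x * h x) (h1 : ∫ x, f x = 1) {b : ℝ} (hb : 0 < b)
    {L : ℝ} (hL : 0 < L) :
    ∫ x, f x * Real.log (f x) ≤
      b ^ 2 * (∫ x, h x) - (1 + Real.log b + Real.log (∫ y in (-L)..L, Real.exp (-y ^ 2))) := by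
  have hf : Continuous f := continuous_iff_continuousAt.2 fun x => (hd x).continuousAt
  have hfi : Integrable f := hf.integrable_of_hasCompactSupport hcs
  obtain ⟨T, hT⟩ := exists_transport hf hfi h0 h1 hL
  set Z := ∫ y in (-L)..L, Real.exp (-y ^ 2) with hZ
  have hZ0 : 0 < Z := intervalIntegral.intervalIntegral_pos_of_pos_on
    ((by fun_prop : Continuous fun y : ℝ => Real.exp (-y ^ 2)).intervalIntegrable _ _)
    (fun y _ => Real.exp_pos _) (by linarith)
  have hTc : Continuous T := continuous_iff_continuousAt.2 fun x => (hT x).continuousAt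
  have hgs : HasCompactSupport g := by
    have : g = deriv f := funext fun x => (hd x).deriv.symm
    rw [this]; exact hcs.deriv
  set T' : ℝ → ℝ := fun x => Z * f x * Real.exp (T x ^ 2) with hT'
  have hT'c : Continuous T' := by fun_prop
  have i1 : Integrable (fun x => f x * T' x) :=
    (hf.mul hT'c).integrable_of_hasCompactSupport hcs.mul_right
  have i2 : Integrable (fun x => g x * T x) :=
    (hg.mul hTc).integrable_of_hasCompactSupport hgs.mul_right
  have i3 : Integrable (fun x => f x * T x) :=
    (hf.mul hTc).integrable_of_hasCompactSupport hcs.mul_right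
  have i4 : Integrable h := hh.integrable_of_hasCompactSupport hhs
  have ibp : ∫ x, f x * T' x = - ∫ x, g x * T x :=
    integral_mul_deriv_eq_deriv_mul_of_integrable (fun x _ => hd x) (fun x _ => hT x) i1 i2 i3
  have i5 : Integrable (fun x => f x * T x ^ 2) :=
    (hf.mul (hTc.pow 2)).integrable_of_hasCompactSupport hcs.mul_right
  set K := 1 + Real.log b + Real.log Z with hK
  -- Where `f > 0`, `log f = log T' - log Z - T²`, and `log (b T') ≤ b T' - 1`.
  have step1 : ∫ x, f x * Real.log (f x) ≤ ∫ x, (b * (f x * T' x) - f x * T x ^ 2 - K * f x) := by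
    refine integral_mono ?_ (((i1.const_mul b).sub i5).sub (hfi.const_mul K)) fun x => ?_
    · refine (Real.continuous_mul_log.comp hf).integrable_of_hasCompactSupport ?_
      exact hcs.comp_left (g := fun x => x * Real.log x) (by simp)
    · simp only
      rcases (h0 x).eq_or_lt with hx | hx
      · simp [← hx]
      · have hT'p : 0 < T' x := by positivity
        have e1 : Real.log (f x) = Real.log (T' x) - Real.log Z - T x ^ 2 := by
          rw [hT']; simp only
          rw [Real.log_mul (by positivity) (by positivity), Real.log_mul hZ0.ne' hx.ne',
            Real.log_exp]; ring
        have e2 : Real.log b + Real.log (T' x) ≤ b * T' x - 1 := by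
          rw [← Real.log_mul hb.ne' hT'p.ne']
          exact Real.log_le_sub_one_of_pos (by positivity)
        have : Real.log (f x) ≤ b * T' x - T x ^ 2 - K := by rw [e1, hK]; linarith
        calc f x * Real.log (f x) ≤ f x * (b * T' x - T x ^ 2 - K) :=
              mul_le_mul_of_nonneg_left this hx.le
          _ = _ := by ring
  -- Pointwise, `(b g T)² ≤ 4 (f T²)(b² h) ≤ (f T² + b² h)²`. The `f T²` term cancels the one in
  -- `step1`.
  have step2 : - (b * ∫ x, g x * T x) ≤ (∫ x, f x * T x ^ 2) + b ^ 2 * ∫ x, h x := by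
    rw [← integral_const_mul, ← integral_const_mul, ← integral_neg,
      ← integral_add i5 (i4.const_mul _)]
    refine integral_mono (i2.const_mul b).neg (i5.add (i4.const_mul _)) fun x => ?_
    simp only
    have a1 : 0 ≤ f x * T x ^ 2 := mul_nonneg (h0 x) (sq_nonneg _)
    have a2 : 0 ≤ b ^ 2 * h x := mul_nonneg (sq_nonneg _) (hh0 x)
    refine (abs_le_of_sq_le_sq' ?_ (add_nonneg a1 a2)).2
    have a3 := mul_le_mul_of_nonneg_left (hfgh x) (sq_nonneg (b * T x))
    nlinarith [sq_nonneg (f x * T x ^ 2 - b ^ 2 * h x)]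
  have i6 : Integrable (fun x => b * (f x * T' x) - f x * T x ^ 2) := (i1.const_mul b).sub i5
  rw [integral_sub i6 (hfi.const_mul K), integral_sub (i1.const_mul b) i5,
    integral_const_mul, integral_const_mul, h1, ibp] at step1
  linarith

/-- Let `L → ∞` in the truncated inequality: the normalization tends to `√π`. -/
theorem entropy_le_of_integral_eq_one {f g h : ℝ → ℝ} (hcs : HasCompactSupport f)
    (h0 : ∀ x, 0 ≤ f x) (hd : ∀ x, HasDerivAt f (g x) x) (hg : Continuous g)
    (hh : Continuous h) (hhs : HasCompactSupport h) (hh0 : ∀ x, 0 ≤ h x)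
    (hfgh : ∀ x, g x ^ 2 ≤ 4 * f x * h x) (h1 : ∫ x, f x = 1) {b : ℝ} (hb : 0 < b) :
    ∫ x, f x * Real.log (f x) ≤
      b ^ 2 * (∫ x, h x) - (1 + Real.log b + Real.log Real.pi / 2) := by
  have hi : Integrable (fun y : ℝ => Real.exp (-y ^ 2)) := by
    simpa using integrable_exp_neg_mul_sq (b := 1) one_pos
  have hlim : Tendsto (fun L : ℝ => ∫ y in (-L)..L, Real.exp (-y ^ 2)) atTop
      (𝓝 (Real.sqrt Real.pi)) := by
    have := intervalIntegral_tendsto_integral hi tendsto_neg_atTop_atBot tendsto_id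
    have h2 : ∫ y : ℝ, Real.exp (-y ^ 2) = Real.sqrt Real.pi := by
      simpa using integral_gaussian 1
    rwa [h2] at this
  have hlog := (Real.continuousAt_log (Real.sqrt_pos.2 Real.pi_pos).ne').tendsto.comp hlim
  rw [Real.log_sqrt Real.pi_pos.le] at hlog
  refine ge_of_tendsto (((hlog.const_add (1 + Real.log b))).const_sub (b ^ 2 * ∫ x, h x)) ?_
  filter_upwards [eventually_gt_atTop 0] with L hL
  exact entropy_le_of_transport hcs h0 hd hg hh hhs hh0 hfgh h1 hb hL

/-- One-dimensional Euclidean logarithmic Sobolev inequality, with the Fisher information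
controlled by `h`. -/
theorem entropy_le_dim_one {f g h : ℝ → ℝ} (hcs : HasCompactSupport f)
    (h0 : ∀ x, 0 ≤ f x) (hd : ∀ x, HasDerivAt f (g x) x) (hg : Continuous g)
    (hh : Continuous h) (hhs : HasCompactSupport h) (hh0 : ∀ x, 0 ≤ h x)
    (hfgh : ∀ x, g x ^ 2 ≤ 4 * f x * h x) {b : ℝ} (hb : 0 < b) :
    ∫ x, f x * Real.log (f x) ≤
      b ^ 2 * (∫ x, h x) + (∫ x, f x) * Real.log (∫ x, f x)
        - (1 + Real.log b + Real.log Real.pi / 2) * ∫ x, f x := by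
  have hf : Continuous f := continuous_iff_continuousAt.2 fun x => (hd x).continuousAt
  have hfi : Integrable f := hf.integrable_of_hasCompactSupport hcs
  have hm0 : 0 ≤ ∫ x, f x := integral_nonneg h0
  set m := ∫ x, f x with hm
  rcases hm0.eq_or_lt with hm0 | hm0
  · have hz : f = 0 := by
      have := (integral_eq_zero_iff_of_nonneg h0 hfi).1 hm0.symm
      exact Continuous.ae_eq_iff_eq volume hf continuous_const |>.1 this
    rw [← hm0, hz]
    simpa using mul_nonneg (sq_nonneg b) (integral_nonneg hh0)
  -- Dividing `f`, `g`, `h` by the mass preserves `g² ≤ 4 f h`, and undoing it produces the term `m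
  -- log m`.
  · have key := entropy_le_of_integral_eq_one (f := fun x => m⁻¹ * f x) (g := fun x => m⁻¹ * g x)
      (h := fun x => m⁻¹ * h x) hcs.mul_left (fun x => mul_nonneg (inv_nonneg.2 hm0.le) (h0 x))
      (fun x => (hd x).const_mul _) (by fun_prop) (by fun_prop) hhs.mul_left
      (fun x => mul_nonneg (inv_nonneg.2 hm0.le) (hh0 x))
      (fun x => by
        have := mul_le_mul_of_nonneg_left (hfgh x) (sq_nonneg m⁻¹)
        nlinarith) (by rw [integral_const_mul, ← hm, inv_mul_cancel₀ hm0.ne']) hb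
    have e1 : ∀ x, m⁻¹ * f x * Real.log (m⁻¹ * f x) =
        m⁻¹ * (f x * Real.log (f x)) - m⁻¹ * Real.log m * f x := by
      intro x
      rcases (h0 x).eq_or_lt with hx | hx
      · simp [← hx]
      · rw [Real.log_mul (inv_ne_zero hm0.ne') hx.ne', Real.log_inv]; ring
    have hfl : Integrable (fun x => f x * Real.log (f x)) :=
      (Real.continuous_mul_log.comp hf).integrable_of_hasCompactSupport
        (hcs.comp_left (g := fun x => x * Real.log x) (by simp))
    simp only [e1] at key
    rw [integral_sub (hfl.const_mul _) (hfi.const_mul _), integral_const_mul, integral_const_mul,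
      integral_const_mul, ← hm] at key
    have := mul_le_mul_of_nonneg_left key hm0.le
    have hmm : m * m⁻¹ = 1 := mul_inv_cancel₀ hm0.ne'
    have e2 : m * (m⁻¹ * (∫ x, f x * Real.log (f x)) - m⁻¹ * Real.log m * m) =
      (m * m⁻¹) * (∫ x, f x * Real.log (f x)) - (m * m⁻¹) * Real.log m * m := by ring
    have e3 : m * (b ^ 2 * (m⁻¹ * ∫ x, h x) - (1 + Real.log b + Real.log Real.pi / 2)) =
      (m * m⁻¹) * (b ^ 2 * ∫ x, h x) - (1 + Real.log b + Real.log Real.pi / 2) * m := by ring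
    rw [e2, e3, hmm] at this
    linarith

/-! ### Integration over slices of `ℝⁿ⁺¹`. -/

theorem HasCompactSupport.exists_fin_cons_eq_zero {n : ℕ} {f : (Fin (n + 1) → ℝ) → ℝ}
    (hf : HasCompactSupport f) :
    ∃ R : ℝ, ∀ (s : ℝ) (y : Fin n → ℝ), s ∉ Icc (-R) R ∨ y ∉ Metric.closedBall 0 R →
      f (Fin.cons s y) = 0 := by
  obtain ⟨R, hR⟩ := hf.isCompact.isBounded.subset_closedBall 0
  refine ⟨R, fun s y h => ?_⟩
  by_contra hne
  have hx := hR (subset_tsupport f hne)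
  have hR0 : 0 ≤ R := dist_nonneg.trans hx
  rw [mem_closedBall_zero_iff, pi_norm_le_iff_of_nonneg hR0] at hx
  rcases h with h | h
  · exact h (abs_le.1 (by simpa using hx 0))
  · refine h ?_
    rw [mem_closedBall_zero_iff, pi_norm_le_iff_of_nonneg hR0]
    exact fun i => by simpa using hx i.succ

theorem Continuous.fin_cons_right {n : ℕ} {f : (Fin (n + 1) → ℝ) → ℝ} (hf : Continuous f)
    (s : ℝ) : Continuous fun y : Fin n → ℝ => f (Fin.cons s y) :=
  hf.comp (Continuous.finCons (A := fun _ => ℝ) continuous_const continuous_id)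

theorem Continuous.fin_cons_left {n : ℕ} {f : (Fin (n + 1) → ℝ) → ℝ} (hf : Continuous f)
    (y : Fin n → ℝ) : Continuous fun s : ℝ => f (Fin.cons s y) :=
  hf.comp (Continuous.finCons (A := fun _ => ℝ) continuous_id continuous_const)

theorem HasCompactSupport.fin_cons_right {n : ℕ} {f : (Fin (n + 1) → ℝ) → ℝ}
    (hf : HasCompactSupport f) (s : ℝ) :
    HasCompactSupport fun y : Fin n → ℝ => f (Fin.cons s y) := by
  obtain ⟨R, hR⟩ := hf.exists_fin_cons_eq_zero
  exact HasCompactSupport.intro (isCompact_closedBall 0 R) fun y hy => hR s y (Or.inr hy)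

theorem HasCompactSupport.integral_fin_cons {n : ℕ} {f : (Fin (n + 1) → ℝ) → ℝ}
    (hf : HasCompactSupport f) :
    HasCompactSupport fun s : ℝ => ∫ y : Fin n → ℝ, f (Fin.cons s y) := by
  obtain ⟨R, hR⟩ := hf.exists_fin_cons_eq_zero
  refine HasCompactSupport.intro isCompact_Icc fun s (hs : s ∉ Icc (-R) R) => ?_
  simp [hR s _ (Or.inl hs)]

/-- The bound is uniform in the first coordinate, as needed for continuity of marginals and for
differentiation under the integral sign. -/
theorem HasCompactSupport.exists_fin_cons_bound {n : ℕ} {f : (Fin (n + 1) → ℝ) → ℝ}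
    (hf : HasCompactSupport f) (hc : Continuous f) :
    ∃ B : (Fin n → ℝ) → ℝ, Integrable B ∧ ∀ s y, ‖f (Fin.cons s y)‖ ≤ B y := by
  obtain ⟨R, hR⟩ := hf.exists_fin_cons_eq_zero
  obtain ⟨C, hC⟩ := hf.exists_bound_of_continuous hc
  refine ⟨(Metric.closedBall 0 R).indicator fun _ => C, ?_, fun s y => ?_⟩
  · exact (integrable_indicator_iff Metric.isClosed_closedBall.measurableSet).2
      (integrableOn_const (isCompact_closedBall _ _).measure_lt_top.ne)
  · by_cases hy : y ∈ Metric.closedBall 0 R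
    · rw [indicator_of_mem hy]; exact hC _
    · rw [indicator_of_notMem hy, hR s y (Or.inr hy), norm_zero]

theorem Continuous.integral_fin_cons {n : ℕ} {f : (Fin (n + 1) → ℝ) → ℝ} (hc : Continuous f)
    (hf : HasCompactSupport f) :
    Continuous fun s : ℝ => ∫ y : Fin n → ℝ, f (Fin.cons s y) := by
  obtain ⟨B, hB, hfB⟩ := hf.exists_fin_cons_bound hc
  exact continuous_of_dominated (fun s => (hc.fin_cons_right s).aestronglyMeasurable)
    (fun s => Eventually.of_forall (hfB s)) hB (Eventually.of_forall fun y => hc.fin_cons_left y)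

theorem integral_eq_integral_fin_cons {n : ℕ} {f : (Fin (n + 1) → ℝ) → ℝ} (hc : Continuous f)
    (hf : HasCompactSupport f) :
    ∫ x, f x = ∫ s : ℝ, ∫ y : Fin n → ℝ, f (Fin.cons s y) := by
  have hmp := (volume_preserving_piFinSuccAbove (fun _ : Fin (n + 1) => ℝ) 0).symm
  have hme := (MeasurableEquiv.piFinSuccAbove (fun _ : Fin (n + 1) => ℝ) 0).symm.measurableEmbedding
  rw [← hmp.integral_comp hme]
  have hi := (hmp.integrable_comp_emb hme).2 (hc.integrable_of_hasCompactSupport hf)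
  have hcons : ∀ (s : ℝ) (y : Fin n → ℝ),
      (MeasurableEquiv.piFinSuccAbove (fun _ : Fin (n + 1) => ℝ) 0).symm (s, y) = Fin.cons s y :=
    fun s y => Fin.insertNth_zero' s y
  simp only [← hcons]
  exact integral_prod _ hi

/-! ### Tensorization to `ℝᵈ`. -/

/-- The quadratic `f t² + g t + h` is nonnegative pointwise, hence so is its integral for every `t`,
and the discriminant is nonpositive. This passes Fisher information to marginals. -/
theorem sq_integral_le_of_sq_le {α : Type*} [MeasurableSpace α] {μ : Measure α} {f g h : α → ℝ}
    (hf : Integrable f μ) (hg : Integrable g μ) (hh : Integrable h μ) (hf0 : ∀ x, 0 ≤ f x)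
    (hh0 : ∀ x, 0 ≤ h x) (hfgh : ∀ x, g x ^ 2 ≤ 4 * f x * h x) :
    (∫ x, g x ∂μ) ^ 2 ≤ 4 * (∫ x, f x ∂μ) * ∫ x, h x ∂μ := by
  have key : ∀ t : ℝ, 0 ≤ (∫ x, f x ∂μ) * (t * t) + (∫ x, g x ∂μ) * t + ∫ x, h x ∂μ := by
    intro t
    have hfg : Integrable (fun x => f x * (t * t) + g x * t) μ :=
      (hf.mul_const _).add (hg.mul_const _)
    rw [← integral_mul_const, ← integral_mul_const, ← integral_add (hf.mul_const _) (hg.mul_const _),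
      ← integral_add hfg hh]
    refine integral_nonneg fun x => ?_
    show 0 ≤ f x * (t * t) + g x * t + h x
    have h1 := hfgh x
    rcases (hf0 x).eq_or_lt with hx | hx
    · have : g x = 0 := by
        rw [← hx] at h1
        exact pow_eq_zero_iff two_ne_zero |>.1 (le_antisymm (by linarith) (sq_nonneg _))
      rw [← hx, this]; linarith [hh0 x]
    · have : 0 ≤ 4 * f x * (f x * (t * t) + g x * t + h x) := by
        nlinarith [sq_nonneg (2 * f x * t + g x)]
      exact nonneg_of_mul_nonneg_right this (by linarith)
  have := discrim_le_zero key
  unfold discrim at this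
  linarith

/-- Euclidean logarithmic Sobolev inequality on `ℝᵈ` for compactly supported densities, with the
Fisher information in each coordinate controlled by `h i`. -/
theorem entropy_le_pi {b : ℝ} (hb : 0 < b) (d : ℕ) :
    ∀ {f : (Fin d → ℝ) → ℝ} {g h : Fin d → (Fin d → ℝ) → ℝ}, Continuous f → HasCompactSupport f →
      (∀ x, 0 ≤ f x) →
      (∀ i x, HasDerivAt (fun t => f (Function.update x i t)) (g i x) (x i)) →
      (∀ i, Continuous (g i)) → (∀ i, Continuous (h i)) → (∀ i, HasCompactSupport (h i)) →
      (∀ i x, 0 ≤ h i x) → (∀ i x, g i x ^ 2 ≤ 4 * f x * h i x) →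
      ∫ x, f x * Real.log (f x) ≤
        b ^ 2 * (∑ i, ∫ x, h i x) + (∫ x, f x) * Real.log (∫ x, f x)
          - d * (1 + Real.log b + Real.log Real.pi / 2) * ∫ x, f x := by
  induction d with
  | zero =>
    intro f g h _ _ _ _ _ _ _ _ _
    simp [integral_unique, Measure.volume_pi_eq_dirac (0 : Fin 0 → ℝ)]
  | succ n ih =>
    intro f g h hc hcs h0 hd hg hh hhs hh0 hfgh
    set K := 1 + Real.log b + Real.log Real.pi / 2 with hK
    -- By `g² ≤ 4 f h`, `g` vanishes wherever `f` does.
    have hgs : HasCompactSupport (g 0) := hcs.mono fun x hx hfx => hx <| by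
      have := hfgh 0 x
      rw [hfx] at this
      exact pow_eq_zero_iff two_ne_zero |>.1 (le_antisymm (by linarith) (sq_nonneg _))
    have hlc : Continuous fun x => f x * Real.log (f x) := Real.continuous_mul_log.comp hc
    have hls : HasCompactSupport fun x => f x * Real.log (f x) :=
      hcs.comp_left (g := fun x => x * Real.log x) (by simp)
    have hint : ∀ {φ : (Fin (n + 1) → ℝ) → ℝ}, Continuous φ → HasCompactSupport φ →
        Integrable fun s : ℝ => ∫ y : Fin n → ℝ, φ (Fin.cons s y) := fun h1 h2 =>
      (h1.integral_fin_cons h2).integrable_of_hasCompactSupport h2.integral_fin_cons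
    have hint' : ∀ {φ : (Fin (n + 1) → ℝ) → ℝ}, Continuous φ → HasCompactSupport φ →
        ∀ s, Integrable fun y : Fin n → ℝ => φ (Fin.cons s y) := fun h1 h2 s =>
      (h1.fin_cons_right s).integrable_of_hasCompactSupport (h2.fin_cons_right s)
    set m : ℝ → ℝ := fun s => ∫ y : Fin n → ℝ, f (Fin.cons s y) with hm
    have hmlog : Integrable fun s => m s * Real.log (m s) :=
      (Real.continuous_mul_log.comp (hc.integral_fin_cons hcs)).integrable_of_hasCompactSupport
        (hcs.integral_fin_cons.comp_left (g := fun x => x * Real.log x) (by simp))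
    have hmd : ∀ s, HasDerivAt m (∫ y : Fin n → ℝ, g 0 (Fin.cons s y)) s := by
      intro s
      obtain ⟨B, hB, hgB⟩ := hgs.exists_fin_cons_bound (hg 0)
      refine (hasDerivAt_integral_of_dominated_loc_of_deriv_le (Filter.univ_mem)
        (Eventually.of_forall fun s => (hc.fin_cons_right s).aestronglyMeasurable)
        (hint' hc hcs s) ((hg 0).fin_cons_right s).aestronglyMeasurable
        (Eventually.of_forall fun y t _ => hgB t y) hB
        (Eventually.of_forall fun y t _ => ?_)).2
      simpa [Fin.update_cons_zero] using hd 0 (Fin.cons t y)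
    have one := entropy_le_dim_one (f := m) (g := fun s => ∫ y : Fin n → ℝ, g 0 (Fin.cons s y))
      (h := fun s => ∫ y : Fin n → ℝ, h 0 (Fin.cons s y)) hcs.integral_fin_cons
      (fun s => integral_nonneg fun y => h0 _) hmd ((hg 0).integral_fin_cons hgs)
      ((hh 0).integral_fin_cons (hhs 0)) (hhs 0).integral_fin_cons
      (fun s => integral_nonneg fun y => hh0 _ _)
      (fun s => sq_integral_le_of_sq_le (hint' hc hcs s) (hint' (hg 0) hgs s)
        (hint' (hh 0) (hhs 0) s) (fun _ => h0 _) (fun _ => hh0 _ _) fun _ => hfgh _ _) hb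
    -- Slices have mass `m s`, not `1`. The term `m log m` left by the induction hypothesis is the
    -- integrand bounded by `one`, so the constants `n K` and `K` add up.
    have slice : ∀ s : ℝ, ∫ y : Fin n → ℝ, f (Fin.cons s y) * Real.log (f (Fin.cons s y)) ≤
        b ^ 2 * (∑ i : Fin n, ∫ y : Fin n → ℝ, h i.succ (Fin.cons s y)) + m s * Real.log (m s)
          - n * K * m s := fun s =>
      ih (g := fun i y => g i.succ (Fin.cons s y)) (h := fun i y => h i.succ (Fin.cons s y))
        (hc.fin_cons_right s) (hcs.fin_cons_right s) (fun _ => h0 _)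
        (fun i y => by simpa [Fin.cons_update] using hd i.succ (Fin.cons s y))
        (fun i => (hg _).fin_cons_right s) (fun i => (hh _).fin_cons_right s)
        (fun i => (hhs _).fin_cons_right s) (fun _ _ => hh0 _ _) (fun _ _ => hfgh _ _)
    have i1 : Integrable fun s => b ^ 2 * (∑ i : Fin n, ∫ y : Fin n → ℝ, h i.succ (Fin.cons s y)) :=
      (integrable_finsetSum _ fun i _ => hint (hh _) (hhs _)).const_mul _
    have i2 : Integrable fun s => n * K * m s := (hint hc hcs).const_mul _
    have i3 : Integrable fun s =>
        b ^ 2 * (∑ i : Fin n, ∫ y : Fin n → ℝ, h i.succ (Fin.cons s y)) + m s * Real.log (m s) :=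
      i1.add hmlog
    have total := integral_mono (hint hlc hls) (i3.sub i2) slice
    rw [integral_eq_integral_fin_cons hlc hls, integral_eq_integral_fin_cons hc hcs,
      Fin.sum_univ_succ]
    simp only [integral_eq_integral_fin_cons (hh _) (hhs _)]
    simp only [Pi.sub_apply] at total
    rw [integral_sub i3 i2, integral_add i1 hmlog, integral_const_mul, integral_const_mul,
      integral_finsetSum _ fun i _ => hint (hh _) (hhs _)] at total
    rw [← hK] at one
    change _ ≤ _ + (∫ s, m s) * Real.log (∫ s, m s) - _ * ∫ s, m s
    push_cast
    linarith

/-- Euclidean logarithmic Sobolev inequality for smooth compactly supported functions. -/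
theorem entropy_sq_le {d : ℕ} {w : EuclideanSpace ℝ (Fin d) → ℝ} (hw : ContDiff ℝ ∞ w)
    (hws : HasCompactSupport w) {b : ℝ} (hb : 0 < b) :
    ∫ x, w x ^ 2 * Real.log (w x ^ 2) ≤
      b ^ 2 * (∑ i, ∫ x, (fderiv ℝ w x (EuclideanSpace.single i 1)) ^ 2)
        + (∫ x, w x ^ 2) * Real.log (∫ x, w x ^ 2)
        - d * (1 + Real.log b + Real.log Real.pi / 2) * ∫ x, w x ^ 2 := by
  have hmp := PiLp.volume_preserving_toLp (Fin d)
  have hme := (MeasurableEquiv.toLp 2 (Fin d → ℝ)).measurableEmbedding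
  have tr : ∀ φ : EuclideanSpace ℝ (Fin d) → ℝ,
      ∫ x, φ x = ∫ x : Fin d → ℝ, φ (WithLp.toLp 2 x) := fun φ =>
    (hmp.integral_comp hme φ).symm
  let e := (EuclideanSpace.equiv (Fin d) ℝ).symm
  have he : ∀ x : Fin d → ℝ, e x = WithLp.toLp 2 x := fun _ => rfl
  have hcomp : ∀ {φ : EuclideanSpace ℝ (Fin d) → ℝ}, HasCompactSupport φ →
      HasCompactSupport fun x : Fin d → ℝ => φ (e x) := fun h =>
    h.comp_homeomorph e.toHomeomorph
  have hw' : ∀ i, Continuous fun x => fderiv ℝ w x (EuclideanSpace.single i 1) := fun i =>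
    (hw.continuous_fderiv (by simp)).clm_apply continuous_const
  have hw's : ∀ i, HasCompactSupport fun x => fderiv ℝ w x (EuclideanSpace.single i 1) := fun i =>
    hws.fderiv_apply (𝕜 := ℝ) _
  simp only [tr, ← he]
  -- For `f = w²` the choice `h i = (∂ᵢw)²` gives equality in `g² ≤ 4 f h`.
  refine entropy_le_pi hb d (g := fun i x => 2 * w (e x) *
    fderiv ℝ w (e x) (EuclideanSpace.single i 1)) ?_ ?_ ?_ ?_ ?_ ?_ ?_ ?_ ?_
  · exact (hw.continuous.comp e.continuous).pow 2
  · exact (hcomp hws).comp_left (g := fun x => x ^ 2) (by simp)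
  · exact fun x => sq_nonneg _
  · intro i x
    have h1 : HasDerivAt (fun t => e (Function.update x i t)) (EuclideanSpace.single i 1) (x i) := by
      have := e.hasFDerivAt.comp_hasDerivAt (x i) (hasDerivAt_update x i (x i))
      exact this
    have h2 : HasFDerivAt w (fderiv ℝ w (e x)) (e (Function.update x i (x i))) := by
      rw [Function.update_eq_self]
      exact (hw.differentiable (by simp) _).hasFDerivAt
    have h3 := (h2.comp_hasDerivAt (x i) h1).pow 2
    refine (h3.congr_deriv ?_ : _)
    simp
  · exact fun i => (continuous_const.mul (hw.continuous.comp e.continuous)).mul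
      ((hw' i).comp e.continuous)
  · exact fun i => ((hw' i).comp e.continuous).pow 2
  · exact fun i => (hcomp (hw's i)).comp_left (g := fun x => x ^ 2) (by simp)
  · exact fun i x => sq_nonneg _
  · intro i x; apply le_of_eq; ring

/-! ### Mollification in `L²`. -/

theorem eLpNorm_two_sq {α F : Type*} [MeasurableSpace α] [NormedAddCommGroup F] (μ : Measure α)
    (f : α → F) : eLpNorm f 2 μ ^ 2 = ∫⁻ x, ‖f x‖ₑ ^ 2 ∂μ := by
  have := eLpNorm_nnreal_pow_eq_lintegral (μ := μ) (f := f) (p := 2) two_ne_zero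
  simpa using this

theorem tendsto_eLpNorm_two_zero_of_dominated {α : Type*} [MeasurableSpace α] {μ : Measure α}
    {F : ℕ → α → ℝ} {k : α → ℝ} (hk : MemLp k 2 μ) (hF : ∀ n, AEStronglyMeasurable (F n) μ)
    (hb : ∀ n x, ‖F n x‖ ≤ ‖k x‖) (hlim : ∀ x, Tendsto (fun n => F n x) atTop (𝓝 0)) :
    Tendsto (fun n => eLpNorm (F n) 2 μ) atTop (𝓝 0) := by
  have h1 : Tendsto (fun n => ∫⁻ x, ‖F n x‖ₑ ^ 2 ∂μ) atTop (𝓝 (∫⁻ _, 0 ∂μ)) := by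
    refine tendsto_lintegral_of_dominated_convergence' (fun x => ‖k x‖ₑ ^ 2)
      (fun n => (hF n).enorm.pow_const 2) (fun n => Eventually.of_forall fun x => ?_) ?_
      (Eventually.of_forall fun x => ?_)
    · exact pow_le_pow_left' (enorm_le_iff_norm_le.2 (hb n x)) 2
    · rw [← eLpNorm_two_sq]
      exact (ENNReal.pow_lt_top hk.2).ne
    · have := ((ENNReal.continuous_pow 2).tendsto _).comp
        ((continuous_enorm.tendsto (0 : ℝ)).comp (hlim x))
      simpa [Function.comp_def] using this
  simp only [lintegral_zero, ← eLpNorm_two_sq] at h1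
  have h2 := ((ENNReal.continuous_rpow_const (y := 1 / 2)).tendsto _).comp h1
  refine (h2.congr fun n => ?_).trans_eq ?_
  · simp only [Function.comp]
    rw [← ENNReal.rpow_natCast, ← ENNReal.rpow_mul]; norm_num
  · norm_num

section Mollify

variable {E : Type*} [NormedAddCommGroup E] [InnerProductSpace ℝ E] [FiniteDimensional ℝ E]
  [MeasurableSpace E] [BorelSpace E]

/-- Convolution with a normalized bump function is a contraction of `L²`. -/
theorem eLpNorm_normed_convolution_le (φ : ContDiffBump (0 : E)) {k : E → ℝ}
    (hk : AEStronglyMeasurable k (volume : Measure E)) :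
    eLpNorm (φ.normed volume ⋆[ContinuousLinearMap.lsmul ℝ ℝ] k) 2 volume
      ≤ eLpNorm k 2 (volume : Measure E) := by
  have hmeas : Measurable fun t => ENNReal.ofReal (φ.normed volume t) :=
    (φ.continuous_normed.measurable).ennreal_ofReal
  set ν : Measure E := volume.withDensity fun t => ENNReal.ofReal (φ.normed volume t) with hν
  have hprob : IsProbabilityMeasure ν := ⟨by
    rw [hν, withDensity_apply _ MeasurableSet.univ, setLIntegral_univ,
      ← ofReal_integral_eq_lintegral_ofReal φ.integrable_normed
        (Eventually.of_forall φ.nonneg_normed), φ.integral_normed, ENNReal.ofReal_one]⟩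
  have hconv : ∀ x, (φ.normed volume ⋆[ContinuousLinearMap.lsmul ℝ ℝ] k) x
      = ∫ t, k (x - t) ∂ν := by
    intro x
    rw [hν, integral_withDensity_eq_integral_toReal_smul hmeas (by simp)]
    refine integral_congr_ae (Eventually.of_forall fun t => ?_)
    simp [ENNReal.toReal_ofReal (φ.nonneg_normed t)]
  have hjoint : AEStronglyMeasurable (fun p : E × E => k (p.1 - p.2)) (volume.prod ν) := by
    have h1 : AEStronglyMeasurable (fun p : E × E => k (p.1 - p.2))
        ((volume : Measure E).prod (volume : Measure E)) :=
      hk.comp_quasiMeasurePreserving (quasiMeasurePreserving_sub_of_right_invariant _ _)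
    exact h1.mono_ac (Measure.AbsolutelyContinuous.rfl.prod (withDensity_absolutelyContinuous _ _))
  -- Jensen's inequality for the probability measure `ν`, as monotonicity of `Lᵖ` norms in `p`;
  -- Tonelli and translation invariance then conclude.
  have hx : ∀ᵐ x : E, ‖∫ t, k (x - t) ∂ν‖ₑ ^ 2 ≤ ∫⁻ t, ‖k (x - t)‖ₑ ^ 2 ∂ν := by
    filter_upwards [hjoint.prodMk_left] with x hx
    rw [← eLpNorm_two_sq]
    gcongr
    refine (enorm_integral_le_lintegral_enorm _).trans ?_
    rw [← eLpNorm_one_eq_lintegral_enorm]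
    exact eLpNorm_le_eLpNorm_of_exponent_le (by norm_num) hx
  refine (ENNReal.pow_le_pow_left_iff two_ne_zero).1 ?_
  rw [eLpNorm_two_sq, eLpNorm_two_sq]
  simp only [hconv]
  calc ∫⁻ x, ‖∫ t, k (x - t) ∂ν‖ₑ ^ 2 ≤ ∫⁻ x, (∫⁻ t, ‖k (x - t)‖ₑ ^ 2 ∂ν) := lintegral_mono_ae hx
    _ = ∫⁻ t, (∫⁻ x, ‖k (x - t)‖ₑ ^ 2) ∂ν :=
        lintegral_lintegral_swap (f := fun x t => ‖k (x - t)‖ₑ ^ 2) (hjoint.enorm.pow_const 2)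
    _ = ∫⁻ x, ‖k x‖ₑ ^ 2 := by
        refine (lintegral_congr fun t =>
          lintegral_sub_right_eq_self (fun x => ‖k x‖ₑ ^ 2) t).trans ?_
        simp

/-- Uniform continuity makes the error uniformly small, and for radius at most `1` it lives in a
fixed ball of finite volume. -/
theorem HasCompactSupport.exists_eLpNorm_normed_convolution_sub_le {g : E → ℝ} (hg : Continuous g)
    (hgs : HasCompactSupport g) {ε : ℝ≥0∞} (hε : ε ≠ 0) :
    ∃ δ > 0, ∀ φ : ContDiffBump (0 : E), φ.rOut ≤ δ →
      eLpNorm (φ.normed volume ⋆[ContinuousLinearMap.lsmul ℝ ℝ] g - g) 2 volume ≤ ε := by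
  obtain ⟨R, hR⟩ := hgs.isCompact.isBounded.subset_closedBall 0
  set B : Set E := Metric.closedBall 0 (R + 1)
  have hBfin : volume B ≠ ⊤ := (isCompact_closedBall _ _).measure_lt_top.ne
  obtain ⟨η, hη0, hη⟩ : ∃ η : ℝ, 0 < η ∧
      volume B ^ ((2 : ℝ≥0∞).toReal⁻¹) * ENNReal.ofReal η ≤ ε := by
    have h1 : Tendsto (fun η : ℝ => volume B ^ ((2 : ℝ≥0∞).toReal⁻¹) * ENNReal.ofReal η) (𝓝[>] 0)
        (𝓝 0) := by
      have h2 : Tendsto (fun η : ℝ => ENNReal.ofReal η) (𝓝[>] 0) (𝓝 (ENNReal.ofReal 0)) :=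
        (ENNReal.continuous_ofReal.tendsto 0).mono_left nhdsWithin_le_nhds
      have h3 := ENNReal.Tendsto.const_mul (a := volume B ^ ((2 : ℝ≥0∞).toReal⁻¹)) h2
        (Or.inr (ENNReal.rpow_ne_top_of_nonneg (by positivity) hBfin))
      simpa using h3
    have := (h1.eventually (eventually_le_nhds (pos_iff_ne_zero.2 hε))).and self_mem_nhdsWithin
    obtain ⟨η, h3, h4⟩ := this.exists
    exact ⟨η, h4, h3⟩
  obtain ⟨δ, hδ0, hδ⟩ := Metric.uniformContinuous_iff.1
    (hgs.uniformContinuous_of_continuous hg) η hη0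
  refine ⟨min δ 1, lt_min hδ0 one_pos, fun φ hφ => ?_⟩
  set F := φ.normed volume ⋆[ContinuousLinearMap.lsmul ℝ ℝ] g - g with hF
  have hpt : ∀ x, ‖F x‖ ≤ η := by
    intro x
    rw [hF, Pi.sub_apply, ← dist_eq_norm]
    refine φ.dist_normed_convolution_le hg.aestronglyMeasurable fun y hy => (hδ ?_).le
    exact (Metric.mem_ball.1 hy).trans_le (hφ.trans (min_le_left _ _))
  have hsupp : ∀ x, x ∉ B → F x = 0 := by
    intro x hx
    have hx' : R + 1 < ‖x‖ := by simpa [B] using hx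
    have hz : ∀ y ∈ Metric.ball x φ.rOut, g y = 0 := by
      intro y hy
      by_contra hne
      have h1 := hR (subset_tsupport g hne)
      rw [mem_closedBall_zero_iff] at h1
      have h2 := (mem_ball_iff_norm.1 hy).trans_le (hφ.trans (min_le_right _ _))
      have h3 := norm_sub_norm_le x y
      rw [norm_sub_rev] at h2
      linarith
    have h0 := hz x (Metric.mem_ball_self φ.rOut_pos)
    rw [hF, Pi.sub_apply, h0, sub_zero,
      φ.normed_convolution_eq_right (fun y hy => by rw [hz y hy, h0]), h0]
  have hind : F = B.indicator F := by
    ext x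
    by_cases hx : x ∈ B
    · rw [indicator_of_mem hx]
    · rw [indicator_of_notMem hx, hsupp x hx]
  rw [hind, eLpNorm_indicator_eq_eLpNorm_restrict Metric.isClosed_closedBall.measurableSet]
  refine (eLpNorm_le_of_ae_bound (C := η) (Eventually.of_forall hpt)).trans ?_
  simpa using hη

/-- Mollification converges in `L²`. -/
theorem MeasureTheory.MemLp.exists_eLpNorm_normed_convolution_sub_le {f : E → ℝ}
    (hf : MemLp f 2 (volume : Measure E)) {ε : ℝ≥0∞} (hε : ε ≠ 0) :
    ∃ δ > 0, ∀ φ : ContDiffBump (0 : E), φ.rOut ≤ δ →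
      eLpNorm (φ.normed volume ⋆[ContinuousLinearMap.lsmul ℝ ℝ] f - f) 2 volume ≤ ε := by
  have hε3 : ε / 3 ≠ 0 := (ENNReal.div_pos hε (by norm_num)).ne'
  obtain ⟨g, hgs, hfg, hg, hg2⟩ := hf.exists_hasCompactSupport_eLpNorm_sub_le (by norm_num) hε3
  obtain ⟨δ, hδ0, hδ⟩ := hgs.exists_eLpNorm_normed_convolution_sub_le hg hε3
  refine ⟨δ, hδ0, fun φ hφ => ?_⟩
  have hl1 : LocallyIntegrable f volume := hf.locallyIntegrable (by norm_num)
  have hl2 : LocallyIntegrable g volume := hg.locallyIntegrable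
  have hcs : HasCompactSupport (φ.normed (volume : Measure E)) := φ.hasCompactSupport_normed
  have hsplit : φ.normed volume ⋆[ContinuousLinearMap.lsmul ℝ ℝ] (f - g)
      = φ.normed volume ⋆[ContinuousLinearMap.lsmul ℝ ℝ] f
        - φ.normed volume ⋆[ContinuousLinearMap.lsmul ℝ ℝ] g := by
    ext x
    have e1 := hcs.convolutionExists_left (ContinuousLinearMap.lsmul ℝ ℝ) φ.continuous_normed hl1 x
    have e2 := hcs.convolutionExists_left (ContinuousLinearMap.lsmul ℝ ℝ) φ.continuous_normed hl2 x
    simp only [Pi.sub_apply, convolution_def]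
    rw [← integral_sub e1 e2]
    simp [mul_sub]
  have hdec : φ.normed volume ⋆[ContinuousLinearMap.lsmul ℝ ℝ] f - f
      = (φ.normed volume ⋆[ContinuousLinearMap.lsmul ℝ ℝ] (f - g)
        + (φ.normed volume ⋆[ContinuousLinearMap.lsmul ℝ ℝ] g - g)) + (g - f) := by
    rw [hsplit]; abel
  have m1 : ∀ {k : E → ℝ}, LocallyIntegrable k volume →
      AEStronglyMeasurable (φ.normed volume ⋆[ContinuousLinearMap.lsmul ℝ ℝ] k) volume := fun hk =>
    (hcs.continuous_convolution_left (ContinuousLinearMap.lsmul ℝ ℝ) φ.continuous_normed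
      hk).aestronglyMeasurable
  have m2 := m1 (hl1.sub hl2)
  have m3 : AEStronglyMeasurable
      (φ.normed volume ⋆[ContinuousLinearMap.lsmul ℝ ℝ] g - g) volume :=
    (m1 hl2).sub hg.aestronglyMeasurable
  rw [hdec]
  calc _ ≤ _ := eLpNorm_add_le (m2.add m3) (hg.aestronglyMeasurable.sub hf.1) (by norm_num)
    _ ≤ (ε / 3 + ε / 3) + ε / 3 := by
        gcongr
        · refine (eLpNorm_add_le m2 m3 (by norm_num)).trans ?_
          gcongr
          · exact (eLpNorm_normed_convolution_le φ (hf.1.sub hg.aestronglyMeasurable)).trans hfg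
          · exact hδ φ hφ
        · rw [eLpNorm_sub_comm]; exact hfg
    _ = ε := ENNReal.add_thirds ε

end Mollify

theorem MeasureTheory.LocallyIntegrable.integrable_mul_of_hasCompactSupport {E : Type*}
    [NormedAddCommGroup E] [InnerProductSpace ℝ E] [FiniteDimensional ℝ E] [MeasurableSpace E]
    [BorelSpace E] {f ψ : E → ℝ} (hf : LocallyIntegrable f volume) (hψ : Continuous ψ)
    (hψs : HasCompactSupport ψ) : Integrable (fun x => f x * ψ x) (volume : Measure E) := by
  simpa [mul_comm] using hf.integrable_smul_left_of_hasCompactSupport hψ hψs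

/-! ### Weak gradients and density of test functions. -/

section WeakGradient

variable {d : ℕ}

local notation "E" => EuclideanSpace ℝ (Fin d)

theorem IsWeakGradient.locallyIntegrable_apply {v : E → ℝ} {G : E → E} (h : IsWeakGradient v G)
    (i : Fin d) : LocallyIntegrable (fun x => G x i) volume := fun x =>
  let ⟨s, hs, hi⟩ := h.locallyIntegrable_grad x
  ⟨s, hs, (EuclideanSpace.proj (𝕜 := ℝ) i).integrable_comp hi⟩

/-- Product rule for weak gradients with a smooth factor. -/
theorem IsWeakGradient.mul_smooth {v : E → ℝ} {G : E → E} (h : IsWeakGradient v G) {η : E → ℝ}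
    {D : E → E} (hη : ContDiff ℝ ∞ η) (hD : Continuous D)
    (hηD : ∀ x i, D x i = fderiv ℝ η x (EuclideanSpace.single i 1)) :
    IsWeakGradient (fun x => η x * v x) (fun x => η x • G x + v x • D x) where
  locallyIntegrable := h.locallyIntegrable.continuous_mul hη.continuous
  locallyIntegrable_grad :=
    (h.locallyIntegrable_grad.continuous_smul hη.continuous).add
      (h.locallyIntegrable.smul_continuous hD)
  integral_eq ψ hψ hψs i := by
    have hψ' : Continuous fun x => fderiv ℝ ψ x (EuclideanSpace.single i 1) :=
      (hψ.continuous_fderiv (by simp)).clm_apply continuous_const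
    have hψ's : HasCompactSupport fun x => fderiv ℝ ψ x (EuclideanSpace.single i 1) :=
      hψs.fderiv_apply (𝕜 := ℝ) _
    have hDi : Continuous fun x => D x i := (EuclideanSpace.proj (𝕜 := ℝ) i).continuous.comp hD
    have hd : ∀ x, fderiv ℝ (fun x => η x * ψ x) x (EuclideanSpace.single i 1)
        = η x * fderiv ℝ ψ x (EuclideanSpace.single i 1) + D x i * ψ x := by
      intro x
      rw [fderiv_fun_mul (hη.differentiable (by simp) x) (hψ.differentiable (by simp) x), hηD]
      simp [mul_comm]
    have key := h.integral_eq (fun x => η x * ψ x) (hη.mul hψ) hψs.mul_left i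
    simp only [hd] at key
    have i1 : Integrable fun x => v x * (η x * fderiv ℝ ψ x (EuclideanSpace.single i 1)) :=
      h.locallyIntegrable.integrable_mul_of_hasCompactSupport (hη.continuous.mul hψ') hψ's.mul_left
    have i2 : Integrable fun x => v x * (D x i * ψ x) :=
      h.locallyIntegrable.integrable_mul_of_hasCompactSupport (hDi.mul hψ.continuous) hψs.mul_left
    have i3 : Integrable fun x => G x i * (η x * ψ x) :=
      (h.locallyIntegrable_apply i).integrable_mul_of_hasCompactSupport
        (hη.continuous.mul hψ.continuous) hψs.mul_left
    simp only [mul_add] at key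
    rw [integral_add i1 i2] at key
    have e1 : ∫ x, η x * v x * fderiv ℝ ψ x (EuclideanSpace.single i 1)
        = ∫ x, v x * (η x * fderiv ℝ ψ x (EuclideanSpace.single i 1)) := by
      congr 1; ext x; ring
    have e2 : ∫ x, (η x • G x + v x • D x) i * ψ x
        = (∫ x, G x i * (η x * ψ x)) + ∫ x, v x * (D x i * ψ x) := by
      rw [← integral_add i3 i2]
      congr 1; ext x; simp; ring
    rw [e1, e2]
    linarith

/-- Mollification turns a weak gradient into a classical one. -/
theorem IsWeakGradient.fderiv_convolution {v : E → ℝ} {G : E → E} (h : IsWeakGradient v G)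
    (φ : ContDiffBump (0 : E)) (x : E) (i : Fin d) :
    fderiv ℝ (φ.normed volume ⋆[ContinuousLinearMap.lsmul ℝ ℝ] v) x (EuclideanSpace.single i 1)
      = (φ.normed volume ⋆[ContinuousLinearMap.lsmul ℝ ℝ] fun y => G y i) x := by
  have hφ : ContDiff ℝ ∞ (φ.normed (volume : Measure E)) := φ.contDiff_normed
  have hcs : HasCompactSupport (φ.normed (volume : Measure E)) := φ.hasCompactSupport_normed
  set ρ := φ.normed (volume : Measure E) with hρ
  have h1 := hcs.hasFDerivAt_convolution_left (ContinuousLinearMap.lsmul ℝ ℝ)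
    (hφ.of_le (by simp)) h.locallyIntegrable x
  have h2 := (hcs.fderiv ℝ).convolutionExists_left
    ((ContinuousLinearMap.lsmul ℝ ℝ).precompL E) (hφ.continuous_fderiv (by simp))
    h.locallyIntegrable x
  rw [h1.fderiv, convolution_def, ContinuousLinearMap.integral_apply h2, convolution_eq_swap]
  have h3 : ∀ t, ((ContinuousLinearMap.precompL E (ContinuousLinearMap.lsmul ℝ ℝ))
      (fderiv ℝ ρ t) (v (x - t))) (EuclideanSpace.single i 1)
      = fderiv ℝ ρ t (EuclideanSpace.single i 1) * v (x - t) := by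
    intro t; simp [ContinuousLinearMap.precompL_apply]
  simp only [h3]
  rw [← integral_sub_left_eq_self _ _ x]
  have h4 : ∀ t, fderiv ℝ (fun t => ρ (x - t)) t (EuclideanSpace.single i 1)
      = - fderiv ℝ ρ (x - t) (EuclideanSpace.single i 1) := by
    intro t
    have h5 : HasFDerivAt (fun t : E => x - t) (-ContinuousLinearMap.id ℝ E) t :=
      (hasFDerivAt_id t).const_sub x
    have h6 := ((hφ.differentiable (by simp) (x - t)).hasFDerivAt).comp t h5
    have h7 : fderiv ℝ (fun t => ρ (x - t)) t = _ := h6.fderiv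
    rw [h7]; simp
  -- The reflected kernel is the test function; its chain-rule sign cancels the minus sign of the
  -- weak gradient.
  have key := h.integral_eq (fun t => ρ (x - t)) (hφ.comp (contDiff_const.sub contDiff_id))
    (hcs.comp_homeomorph (Homeomorph.subLeft x)) i
  simp only [h4, mul_neg, integral_neg, neg_inj] at key
  simp only [sub_sub_cancel]
  calc _ = ∫ t, v t * fderiv ℝ ρ (x - t) (EuclideanSpace.single i 1) := by simp [mul_comm]
    _ = _ := by rw [key]; simp [mul_comm]

theorem MeasureTheory.MemLp.euclidean_apply {H : E → E} (hH : MemLp H 2 volume) (i : Fin d) :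
    MemLp (fun x => H x i) 2 volume :=
  (EuclideanSpace.proj (𝕜 := ℝ) i).comp_memLp' hH

/-- A mollification of radius at most `1` differs from `u` only where `‖x‖ ≤ |R| + 1`, so the
weighted error is at most `|R| + 1` times the plain one. This dictates `ε'`. -/
theorem IsWeakGradient.exists_smooth_approx_of_hasCompactSupport {u : E → ℝ} {H : E → E}
    (h : IsWeakGradient u H) (hu : MemLp u 2 volume) (hH : MemLp H 2 volume)
    (hus : HasCompactSupport u) {ε : ℝ≥0∞} (hε : ε ≠ 0) :
    ∃ w : E → ℝ, ContDiff ℝ ∞ w ∧ HasCompactSupport w ∧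
      eLpNorm (fun x => w x - u x) 2 volume ≤ ε ∧
      eLpNorm (fun x => ‖x‖ * (w x - u x)) 2 volume ≤ ε ∧
      ∀ i, eLpNorm (fun x => fderiv ℝ w x (EuclideanSpace.single i 1) - H x i) 2 volume ≤ ε := by
  obtain ⟨R, hR⟩ := hus.isCompact.isBounded.subset_closedBall 0
  have hR1 : 0 < |R| + 1 := by positivity
  set ε' := min ε (ε / ENNReal.ofReal (|R| + 1)) with hε'
  have hε'0 : ε' ≠ 0 :=
    (lt_min (pos_iff_ne_zero.2 hε) (ENNReal.div_pos hε ENNReal.ofReal_ne_top)).ne'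
  obtain ⟨δ₀, hδ₀, h₀⟩ := hu.exists_eLpNorm_normed_convolution_sub_le hε'0
  choose δ hδ hi using fun i => (hH.euclidean_apply i).exists_eLpNorm_normed_convolution_sub_le hε
  obtain ⟨r, hr0, hr1, hr2, hr3⟩ : ∃ r : ℝ, 0 < r ∧ r ≤ 1 ∧ r ≤ δ₀ ∧ ∀ i, r ≤ δ i := by
    have e : ∀ {a : ℝ}, 0 < a → ∀ᶠ r in 𝓝[>] (0 : ℝ), r ≤ a := fun ha =>
      (eventually_le_nhds ha).filter_mono nhdsWithin_le_nhds
    have e0 : ∀ᶠ r in 𝓝[>] (0 : ℝ), 0 < r := self_mem_nhdsWithin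
    obtain ⟨r, hr⟩ := ((e0.and (e one_pos)).and
      ((e hδ₀).and (eventually_all.2 fun i => e (hδ i)))).exists
    exact ⟨r, hr.1.1, hr.1.2, hr.2.1, hr.2.2⟩
  let φ : ContDiffBump (0 : E) := ⟨r / 2, r, half_pos hr0, half_lt_self hr0⟩
  have hcs : HasCompactSupport (φ.normed (volume : Measure E)) := φ.hasCompactSupport_normed
  set w := φ.normed (volume : Measure E) ⋆[ContinuousLinearMap.lsmul ℝ ℝ] u with hw
  have hclose : eLpNorm (fun x => w x - u x) 2 volume ≤ ε' := h₀ φ hr2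
  have hsupp : ∀ x, |R| + 1 < ‖x‖ → w x - u x = 0 := by
    intro x hx
    have hux : u x = 0 := by
      by_contra hne
      have := hR (subset_tsupport u hne)
      rw [mem_closedBall_zero_iff] at this
      linarith [le_abs_self R]
    rw [hux, sub_zero]
    by_contra hne
    obtain ⟨a, ha, b, hb, rfl⟩ := support_convolution_subset (ContinuousLinearMap.lsmul ℝ ℝ) hne
    rw [φ.support_normed_eq, mem_ball_zero_iff] at ha
    have hb' := hR (subset_tsupport u hb)
    rw [mem_closedBall_zero_iff] at hb'
    have : ‖a‖ < r := ha
    linarith [norm_add_le a b, le_abs_self R]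
  refine ⟨w, hcs.contDiff_convolution_left _ φ.contDiff_normed h.locallyIntegrable,
    HasCompactSupport.convolution _ hcs hus, hclose.trans (min_le_left _ _), ?_, fun i => ?_⟩
  · calc eLpNorm (fun x => ‖x‖ * (w x - u x)) 2 volume
        ≤ ENNReal.ofReal (|R| + 1) * eLpNorm (fun x => w x - u x) 2 volume := by
          refine eLpNorm_le_mul_eLpNorm_of_ae_le_mul (Eventually.of_forall fun x => ?_) 2
          rcases le_or_gt ‖x‖ (|R| + 1) with hx | hx
          · rw [norm_mul, norm_norm]; gcongr
          · rw [hsupp x hx]; simp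
      _ ≤ ENNReal.ofReal (|R| + 1) * (ε / ENNReal.ofReal (|R| + 1)) := by
          gcongr; exact hclose.trans (min_le_right _ _)
      _ ≤ ε := ENNReal.mul_div_le
  · have := hi i φ (hr3 i)
    simp only [hw, h.fderiv_convolution]
    exact this

/-- Smooth compactly supported functions are dense in the Sobolev space with weight. -/
theorem IsWeakGradient.exists_smooth_approx {u : E → ℝ} {H : E → E}
    (h : IsWeakGradient u H) (hu : MemLp u 2 volume) (hxu : MemLp (fun x => ‖x‖ * u x) 2 volume)
    (hH : MemLp H 2 volume) {ε : ℝ≥0∞} (hε : ε ≠ 0) :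
    ∃ w : E → ℝ, ContDiff ℝ ∞ w ∧ HasCompactSupport w ∧
      eLpNorm (fun x => w x - u x) 2 volume ≤ ε ∧
      eLpNorm (fun x => ‖x‖ * (w x - u x)) 2 volume ≤ ε ∧
      ∀ i, eLpNorm (fun x => fderiv ℝ w x (EuclideanSpace.single i 1) - H x i) 2 volume ≤ ε := by
  let χ : ContDiffBump (0 : E) := ⟨1, 2, one_pos, one_lt_two⟩
  have hχ : ContDiff ℝ ∞ χ := χ.contDiff
  obtain ⟨C, hC⟩ := (χ.hasCompactSupport.fderiv ℝ).exists_bound_of_continuous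
    (hχ.continuous_fderiv (by simp))
  set c : ℕ → ℝ := fun n => 1 / ((n : ℝ) + 1) with hc
  have hc0 : ∀ n, 0 < c n := fun n => Nat.one_div_pos_of_nat
  have hc1 : ∀ n, c n ≤ 1 := fun n => by
    rw [hc]; simp only
    rw [div_le_one (by positivity)]
    linarith [(Nat.cast_nonneg n : (0 : ℝ) ≤ n)]
  have hclim : Tendsto c atTop (𝓝 0) := tendsto_one_div_add_atTop_nhds_zero_nat
  set η : ℕ → E → ℝ := fun n x => χ (c n • x) with hη
  have hηs : ∀ n, ContDiff ℝ ∞ (η n) := fun n => hχ.comp (contDiff_id.const_smul (c n))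
  have hηcs : ∀ n, HasCompactSupport (η n) := fun n =>
    χ.hasCompactSupport.comp_homeomorph (Homeomorph.smulOfNeZero (c n) (hc0 n).ne')
  have hη01 : ∀ n x, |η n x - 1| ≤ 1 := fun n x => by
    rw [abs_le]
    constructor <;> linarith [χ.nonneg' (c n • x), χ.le_one (x := c n • x)]
  have hηnorm : ∀ n x, ‖η n x‖ ≤ 1 := fun n x => by
    rw [Real.norm_of_nonneg (χ.nonneg' _)]; exact χ.le_one
  have hηlim : ∀ x, Tendsto (fun n => η n x) atTop (𝓝 1) := fun x => by
    refine tendsto_const_nhds.congr' ?_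
    have h1 : Tendsto (fun n => ‖c n • x‖) atTop (𝓝 0) := by
      simpa using (hclim.smul_const x).norm
    filter_upwards [h1.eventually (eventually_le_nhds one_pos)] with n hn
    exact (χ.one_of_mem_closedBall (by simpa [χ] using hn)).symm
  have hηd : ∀ n x y, fderiv ℝ (η n) x y = c n * fderiv ℝ χ (c n • x) y := by
    intro n x y
    have h5 : HasFDerivAt (fun x : E => c n • x) (c n • ContinuousLinearMap.id ℝ E) x :=
      (hasFDerivAt_id x).const_smul (c n)
    have h6 := ((hχ.differentiable (by simp) (c n • x)).hasFDerivAt).comp x h5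
    have h7 : fderiv ℝ (η n) x = _ := h6.fderiv
    rw [h7]; simp
  have hsingle : ∀ i : Fin d, ‖(EuclideanSpace.single i (1 : ℝ) : E)‖ = 1 := fun i => by simp
  have hηdb : ∀ n x i, |fderiv ℝ (η n) x (EuclideanSpace.single i 1)| ≤ c n * C := by
    intro n x i
    rw [hηd, abs_mul, abs_of_pos (hc0 n)]
    refine mul_le_mul_of_nonneg_left (((fderiv ℝ χ (c n • x)).le_opNorm _).trans ?_) (hc0 n).le
    rw [hsingle, mul_one]; exact hC _
  have hC0 : 0 ≤ C := (norm_nonneg _).trans (hC 0)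
  set D : ℕ → E → E := fun n x => WithLp.toLp 2 fun i =>
    fderiv ℝ (η n) x (EuclideanSpace.single i 1) with hDdef
  have hDc : ∀ n i, Continuous fun x => fderiv ℝ (η n) x (EuclideanSpace.single i 1) := fun n i =>
    ((hηs n).continuous_fderiv (by simp)).clm_apply continuous_const
  have hD : ∀ n, Continuous (D n) := fun n =>
    (PiLp.continuous_toLp 2 _).comp (continuous_pi fun i => hDc n i)
  have hweak : ∀ n, IsWeakGradient (fun x => η n x * u x) (fun x => η n x • H x + u x • D n x) :=
    fun n => h.mul_smooth (hηs n) (hD n) fun x i => rfl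
  have t1 := tendsto_eLpNorm_two_zero_of_dominated (F := fun n x => (η n x - 1) * u x) hu
    (fun n => ((hηs n).continuous.aestronglyMeasurable.sub aestronglyMeasurable_const).mul hu.1)
    (fun n x => by
      rw [norm_mul]
      exact mul_le_of_le_one_left (norm_nonneg _) (hη01 n x))
    (fun x => by simpa using ((hηlim x).sub_const 1).mul_const (u x))
  have t2 := tendsto_eLpNorm_two_zero_of_dominated (F := fun n x => (η n x - 1) * (‖x‖ * u x)) hxu
    (fun n => ((hηs n).continuous.aestronglyMeasurable.sub aestronglyMeasurable_const).mul hxu.1)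
    (fun n x => by
      rw [norm_mul]
      exact mul_le_of_le_one_left (norm_nonneg _) (hη01 n x))
    (fun x => by simpa using ((hηlim x).sub_const 1).mul_const (‖x‖ * u x))
  have t3 := fun i => tendsto_eLpNorm_two_zero_of_dominated (F := fun n x => (η n x - 1) * H x i)
    (hH.euclidean_apply i)
    (fun n => ((hηs n).continuous.aestronglyMeasurable.sub aestronglyMeasurable_const).mul
      (hH.euclidean_apply i).1)
    (fun n x => by
      rw [norm_mul]
      exact mul_le_of_le_one_left (norm_nonneg _) (hη01 n x))
    (fun x => by simpa using ((hηlim x).sub_const 1).mul_const (H x i))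
  -- The error from differentiating the cutoff: the gradient of `χ (c n • x)` is at most `c n * C`.
  have t4 := fun i => tendsto_eLpNorm_two_zero_of_dominated (F := fun n x => u x * D n x i)
    (hu.const_mul C) (fun n => hu.1.mul (hDc n i).aestronglyMeasurable)
    (fun n x => by
      rw [norm_mul, norm_mul, mul_comm, Real.norm_of_nonneg hC0]
      gcongr
      refine (hηdb n x i).trans ?_
      exact mul_le_of_le_one_left hC0 (hc1 n))
    (fun x => by
      have : Tendsto (fun n => D n x i) atTop (𝓝 0) :=
        squeeze_zero_norm (fun n => hηdb n x i) (by simpa using hclim.mul_const C)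
      simpa using this.const_mul (u x))
  have hε3 : ε / 3 ≠ 0 := (ENNReal.div_pos hε (by norm_num)).ne'
  have ev : ∀ {a : ℕ → ℝ≥0∞}, Tendsto a atTop (𝓝 0) → ∀ᶠ n in atTop, a n ≤ ε / 3 := fun ha =>
    ha.eventually (eventually_le_nhds (pos_iff_ne_zero.2 hε3))
  obtain ⟨n, hn⟩ := (((ev t1).and (ev t2)).and
    ((eventually_all.2 fun i => ev (t3 i)).and (eventually_all.2 fun i => ev (t4 i)))).exists
  obtain ⟨⟨n1, n2⟩, n3, n4⟩ := hn
  have mu : MemLp (fun x => η n x * u x) 2 volume :=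
    hu.of_le ((hηs n).continuous.aestronglyMeasurable.mul hu.1) (Eventually.of_forall fun x => by
      rw [norm_mul]; exact mul_le_of_le_one_left (norm_nonneg _) (hηnorm n x))
  have mH : MemLp (fun x => η n x • H x + u x • D n x) 2 volume := by
    have m1 : MemLp (fun x => η n x • H x) 2 volume :=
      hH.of_le ((hηs n).continuous.aestronglyMeasurable.smul hH.1) (Eventually.of_forall fun x => by
        rw [norm_smul]; exact mul_le_of_le_one_left (norm_nonneg _) (hηnorm n x))
    obtain ⟨B, hB⟩ : ∃ B, ∀ x, ‖D n x‖ ≤ B := by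
      have : HasCompactSupport (D n) := HasCompactSupport.intro (hηcs n).isCompact fun x hx => by
        have h0 : fderiv ℝ (η n) x = 0 := by
          by_contra hne
          exact hx (support_fderiv_subset ℝ hne)
        ext i; simp [hDdef, h0]
      exact this.exists_bound_of_continuous (hD n)
    have m2 : MemLp (fun x => u x • D n x) 2 volume :=
      hu.of_le_mul (c := B) (hu.1.smul (hD n).aestronglyMeasurable) (Eventually.of_forall fun x => by
        rw [norm_smul, mul_comm]; gcongr; exact hB x)
    exact m1.add m2
  obtain ⟨w, hw, hws, w1, w2, w3⟩ := (hweak n).exists_smooth_approx_of_hasCompactSupport mu mH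
    (hηcs n).mul_right hε3
  have hε2 : ε / 3 + ε / 3 ≤ ε := (le_add_right le_rfl).trans_eq (ENNReal.add_thirds ε)
  refine ⟨w, hw, hws, ?_, ?_, fun i => ?_⟩
  · have e : (fun x => w x - u x) = (fun x => w x - η n x * u x) + fun x => (η n x - 1) * u x := by
      ext x; simp only [Pi.add_apply]; ring
    rw [e]
    refine (eLpNorm_add_le (hw.continuous.aestronglyMeasurable.sub mu.1)
      (((hηs n).continuous.aestronglyMeasurable.sub aestronglyMeasurable_const).mul hu.1)
      (by norm_num)).trans ?_
    exact (add_le_add w1 n1).trans hε2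
  · have e : (fun x => ‖x‖ * (w x - u x))
        = (fun x => ‖x‖ * (w x - η n x * u x)) + fun x => (η n x - 1) * (‖x‖ * u x) := by
      ext x; simp only [Pi.add_apply]; ring
    rw [e]
    refine (eLpNorm_add_le (continuous_norm.aestronglyMeasurable.mul
      (hw.continuous.aestronglyMeasurable.sub mu.1))
      (((hηs n).continuous.aestronglyMeasurable.sub aestronglyMeasurable_const).mul hxu.1)
      (by norm_num)).trans ?_
    exact (add_le_add w2 n2).trans hε2
  · have e : (fun x => fderiv ℝ w x (EuclideanSpace.single i 1) - H x i)
        = (fun x => fderiv ℝ w x (EuclideanSpace.single i 1) - (η n x • H x + u x • D n x) i)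
          + ((fun x => (η n x - 1) * H x i) + fun x => u x * D n x i) := by
      ext x; simp only [Pi.add_apply, PiLp.add_apply, PiLp.smul_apply, smul_eq_mul]; ring
    have hwm : AEStronglyMeasurable (fun x => fderiv ℝ w x (EuclideanSpace.single i 1)) volume :=
      ((hw.continuous_fderiv (by simp)).clm_apply continuous_const).aestronglyMeasurable
    have a1 : AEStronglyMeasurable (fun x => (η n x - 1) * H x i) volume :=
      ((hηs n).continuous.aestronglyMeasurable.sub aestronglyMeasurable_const).mul
        (hH.euclidean_apply i).1
    have a2 : AEStronglyMeasurable (fun x => u x * D n x i) volume :=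
      hu.1.mul (hDc n i).aestronglyMeasurable
    rw [e]
    refine (eLpNorm_add_le (hwm.sub (mH.euclidean_apply i).1) (a1.add a2) (by norm_num)).trans ?_
    refine (add_le_add (w3 i) ((eLpNorm_add_le a1 a2 (by norm_num)).trans
      (add_le_add (n3 i) (n4 i)))).trans_eq ?_
    rw [← add_assoc]; exact ENNReal.add_thirds ε

end WeakGradient

/-! ### Passing to the limit in the logarithmic Sobolev inequality. -/

theorem tendsto_integral_mul_of_tendsto_eLpNorm_two {α : Type*} [MeasurableSpace α] {μ : Measure α}
    {F K : ℕ → α → ℝ} {f k : α → ℝ} (hF : ∀ n, MemLp (F n) 2 μ) (hK : ∀ n, MemLp (K n) 2 μ)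
    (hf : MemLp f 2 μ) (hk : MemLp k 2 μ)
    (hFf : Tendsto (fun n => eLpNorm (fun x => F n x - f x) 2 μ) atTop (𝓝 0))
    (hKk : Tendsto (fun n => eLpNorm (fun x => K n x - k x) 2 μ) atTop (𝓝 0)) :
    Tendsto (fun n => ∫ x, F n x * K n x ∂μ) atTop (𝓝 (∫ x, f x * k x ∂μ)) := by
  have h1 := (Lp.tendsto_Lp_iff_tendsto_eLpNorm'' F hF f hf).2 hFf
  have h2 := (Lp.tendsto_Lp_iff_tendsto_eLpNorm'' K hK k hk).2 hKk
  have h3 := h1.inner (𝕜 := ℝ) h2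
  have e : ∀ {a b : α → ℝ} (ha : MemLp a 2 μ) (hb : MemLp b 2 μ),
      inner ℝ (ha.toLp a) (hb.toLp b) = ∫ x, a x * b x ∂μ := by
    intro a b ha hb
    rw [L2.inner_def]
    refine integral_congr_ae ?_
    filter_upwards [ha.coeFn_toLp, hb.coeFn_toLp] with x h4 h5
    simp [h4, h5, mul_comm]
  simpa only [e] using h3

/-- Fatou's lemma for nonnegative real functions with converging bounds on the integrals. -/
theorem integrable_and_integral_le_of_tendsto_ae {α : Type*} [MeasurableSpace α] {μ : Measure α}
    {F : ℕ → α → ℝ} {f : α → ℝ} {a : ℕ → ℝ} {A : ℝ} (hF : ∀ n, Integrable (F n) μ)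
    (hF0 : ∀ n x, 0 ≤ F n x) (hf0 : ∀ x, 0 ≤ f x)
    (hlim : ∀ᵐ x ∂μ, Tendsto (fun n => F n x) atTop (𝓝 (f x)))
    (hle : ∀ n, ∫ x, F n x ∂μ ≤ a n) (ha : Tendsto a atTop (𝓝 A)) :
    Integrable f μ ∧ ∫ x, f x ∂μ ≤ A := by
  have hA : 0 ≤ A := ge_of_tendsto' ha fun n => (integral_nonneg (hF0 n)).trans (hle n)
  have hm : AEStronglyMeasurable f μ := aestronglyMeasurable_of_tendsto_ae _ (fun n => (hF n).1) hlim
  have key : ∫⁻ x, ENNReal.ofReal (f x) ∂μ ≤ ENNReal.ofReal A := by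
    calc ∫⁻ x, ENNReal.ofReal (f x) ∂μ
        = ∫⁻ x, liminf (fun n => ENNReal.ofReal (F n x)) atTop ∂μ := by
          refine lintegral_congr_ae ?_
          filter_upwards [hlim] with x hx
          exact ((ENNReal.continuous_ofReal.tendsto _).comp hx).liminf_eq.symm
      _ ≤ liminf (fun n => ∫⁻ x, ENNReal.ofReal (F n x) ∂μ) atTop :=
          lintegral_liminf_le' fun n => (hF n).1.aemeasurable.ennreal_ofReal
      _ ≤ liminf (fun n => ENNReal.ofReal (a n)) atTop := by
          refine liminf_le_liminf (Eventually.of_forall fun n => ?_)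
          rw [← ofReal_integral_eq_lintegral_ofReal (hF n) (Eventually.of_forall (hF0 n))]
          exact ENNReal.ofReal_le_ofReal (hle n)
      _ = ENNReal.ofReal A := ((ENNReal.continuous_ofReal.tendsto _).comp ha).liminf_eq
  have hi : Integrable f μ := by
    refine ⟨hm, ?_⟩
    rw [hasFiniteIntegral_iff_ofReal (Eventually.of_forall hf0)]
    exact key.trans_lt ENNReal.ofReal_lt_top
  refine ⟨hi, ?_⟩
  rw [← ofReal_integral_eq_lintegral_ofReal hi (Eventually.of_forall hf0)] at key
  exact (ENNReal.ofReal_le_ofReal_iff hA).1 key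

/-- This is `log s ≥ 1 - 1/s` at `s = t exp c`. Adding the integrable function `exp(-c)` makes the
relative entropy integrand nonnegative, as Fatou's lemma requires. -/
theorem mul_log_add_ge (c : ℝ) {t : ℝ} (ht : 0 ≤ t) :
    0 ≤ t * (Real.log t + c) + Real.exp (-c) := by
  rcases ht.eq_or_lt with rfl | ht
  · simpa using (Real.exp_pos _).le
  · have h1 := Real.one_sub_inv_le_log_of_pos (x := t * Real.exp c) (by positivity)
    rw [Real.log_mul ht.ne' (Real.exp_pos _).ne', Real.log_exp] at h1
    have h2 := mul_le_mul_of_nonneg_left h1 ht.le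
    have h3 : t * (1 - (t * Real.exp c)⁻¹) = t - Real.exp (-c) := by
      rw [Real.exp_neg]; field_simp
    linarith

theorem integrable_exp_neg_half_sq_norm (d : ℕ) (c : ℝ) :
    Integrable fun x : EuclideanSpace ℝ (Fin d) => Real.exp (-(c + ‖x‖ ^ 2 / 2)) := by
  have h1 : Integrable fun x : EuclideanSpace ℝ (Fin d) => Real.exp (-(1 / 2) * ‖x‖ ^ 2) := by
    -- A non-integrable function has integral `0` by convention, so a nonzero value proves
    -- integrability.
    refine Integrable.of_integral_ne_zero ?_
    rw [GaussianFourier.integral_rexp_neg_mul_sq_norm (by norm_num)]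
    positivity
  refine (h1.const_mul (Real.exp (-c))).congr (Eventually.of_forall fun x => ?_)
  simp only
  rw [← Real.exp_add]; ring_nf

section Limit

variable {d : ℕ}

local notation "E" => EuclideanSpace ℝ (Fin d)

theorem norm_coord_mul_le (i : Fin d) (x : E) (r : ℝ) : ‖x i * r‖ ≤ ‖‖x‖ * r‖ := by
  rw [norm_mul, norm_mul, norm_norm]
  gcongr
  exact PiLp.norm_apply_le x i

/-- Integrate by parts in `xᵢ ∂ᵢ(w²) / 2`. Summed over `i`, this gives the term `-d/2` in the
comparison of the two Fisher informations. -/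
theorem integral_mul_coord_fderiv {w : E → ℝ} (hw : ContDiff ℝ ∞ w) (hws : HasCompactSupport w)
    (i : Fin d) :
    ∫ x, (x i * w x) * fderiv ℝ w x (EuclideanSpace.single i 1) = - (1 / 2) * ∫ x, w x * w x := by
  have hw' : Continuous fun x => fderiv ℝ w x (EuclideanSpace.single i 1) :=
    (hw.continuous_fderiv (by simp)).clm_apply continuous_const
  have hp : ∀ x : E, HasFDerivAt (fun x : E => x i) (EuclideanSpace.proj (𝕜 := ℝ) i) x := fun x =>
    (EuclideanSpace.proj (𝕜 := ℝ) i).hasFDerivAt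
  have hpc : Continuous fun x : E => x i := (EuclideanSpace.proj (𝕜 := ℝ) i).continuous
  have e1 : ∀ x : E, fderiv ℝ (fun x : E => x i) x (EuclideanSpace.single i 1) = 1 := fun x => by
    rw [(hp x).fderiv]; simp
  have e2 : ∀ x : E, fderiv ℝ (fun x => w x * w x) x (EuclideanSpace.single i 1)
      = 2 * (w x * fderiv ℝ w x (EuclideanSpace.single i 1)) := fun x => by
    rw [fderiv_fun_mul (hw.differentiable (by simp) x) (hw.differentiable (by simp) x)]
    simp; ring
  have key := integral_mul_fderiv_eq_neg_fderiv_mul_of_integrable (μ := volume)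
    (f := fun x : E => x i) (g := fun x => w x * w x) (v := EuclideanSpace.single i 1) ?_ ?_ ?_
    (fun x _ => (hp x).differentiableAt)
    (fun x _ => (hw.differentiable (by simp) x).mul (hw.differentiable (by simp) x))
  · simp only [e1, e2, one_mul] at key
    have e3 : ∫ x : E, x i * (2 * (w x * fderiv ℝ w x (EuclideanSpace.single i 1)))
        = 2 * ∫ x : E, (x i * w x) * fderiv ℝ w x (EuclideanSpace.single i 1) := by
      rw [← integral_const_mul]; congr 1; ext x; ring
    rw [e3] at key
    linarith
  · simp only [e1, one_mul]
    exact (hw.continuous.mul hw.continuous).integrable_of_hasCompactSupport hws.mul_right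
  · simp only [e2]
    exact (hpc.mul (continuous_const.mul (hw.continuous.mul hw'))).integrable_of_hasCompactSupport
      hws.mul_right.mul_left.mul_left
  · exact (hpc.mul (hw.continuous.mul hw.continuous)).integrable_of_hasCompactSupport
      hws.mul_right.mul_left

/-- Logarithmic Sobolev inequality for smooth functions, with Gaussian reference density
`exp (-(c + ‖x‖² / 2))` in the entropy. -/
theorem integral_relative_entropy_le {w : E → ℝ} (hw : ContDiff ℝ ∞ w) (hws : HasCompactSupport w)
    (c : ℝ) {b : ℝ} (hb : 0 < b) :
    Integrable (fun x => w x ^ 2 * (Real.log (w x ^ 2) + (c + ‖x‖ ^ 2 / 2))) ∧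
    ∫ x, w x ^ 2 * (Real.log (w x ^ 2) + (c + ‖x‖ ^ 2 / 2)) ≤
      b ^ 2 * (∑ i, ∫ x, fderiv ℝ w x (EuclideanSpace.single i 1) *
          fderiv ℝ w x (EuclideanSpace.single i 1))
        + (∫ x, w x * w x) * Real.log (∫ x, w x * w x)
        - d * (1 + Real.log b + Real.log Real.pi / 2) * (∫ x, w x * w x)
        + c * (∫ x, w x * w x) + 1 / 2 * ∫ x, (‖x‖ * w x) * (‖x‖ * w x) := by
  have key := entropy_sq_le hw hws hb
  have hs2 : HasCompactSupport fun x => w x ^ 2 := hws.comp_left (g := fun x => x ^ 2) (by simp)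
  have hc2 : Continuous fun x => w x ^ 2 := hw.continuous.pow 2
  have i1 : Integrable fun x => w x ^ 2 * Real.log (w x ^ 2) :=
    (Real.continuous_mul_log.comp hc2).integrable_of_hasCompactSupport
      (hs2.comp_left (g := fun x => x * Real.log x) (by simp))
  have i2 : Integrable fun x => c * w x ^ 2 :=
    (continuous_const.mul hc2).integrable_of_hasCompactSupport hs2.mul_left
  have i3 : Integrable fun x => 1 / 2 * ((‖x‖ * w x) * (‖x‖ * w x)) :=
    (continuous_const.mul ((continuous_norm.mul hw.continuous).mul
      (continuous_norm.mul hw.continuous))).integrable_of_hasCompactSupport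
      hws.mul_left.mul_left.mul_left
  have i4 : Integrable fun x => w x ^ 2 * Real.log (w x ^ 2) + c * w x ^ 2 := i1.add i2
  have e : (fun x => w x ^ 2 * (Real.log (w x ^ 2) + (c + ‖x‖ ^ 2 / 2)))
      = fun x => (w x ^ 2 * Real.log (w x ^ 2) + c * w x ^ 2)
        + 1 / 2 * ((‖x‖ * w x) * (‖x‖ * w x)) := by
    ext x; ring
  rw [e]
  refine ⟨i4.add i3, ?_⟩
  rw [integral_add i4 i3, integral_add i1 i2, integral_const_mul, integral_const_mul]
  simp only [sq] at key ⊢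
  linarith

/-- Passing to the limit from smooth functions to weakly differentiable ones. -/
theorem IsWeakGradient.relative_entropy_le {u : E → ℝ} {H : E → E} (h : IsWeakGradient u H)
    (hu : MemLp u 2 volume) (hxu : MemLp (fun x => ‖x‖ * u x) 2 volume) (hH : MemLp H 2 volume)
    (hnorm : ∫ x, u x * u x = 1) (c : ℝ) :
    (∀ i, ∫ x, (x i * u x) * H x i = - (1 / 2)) ∧
    Integrable (fun x => u x ^ 2 * (Real.log (u x ^ 2) + (c + ‖x‖ ^ 2 / 2))) ∧
    ∀ b : ℝ, 0 < b → ∫ x, u x ^ 2 * (Real.log (u x ^ 2) + (c + ‖x‖ ^ 2 / 2)) ≤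
      b ^ 2 * (∑ i, ∫ x, H x i * H x i) - d * (1 + Real.log b + Real.log Real.pi / 2)
        + c + 1 / 2 * ∫ x, (‖x‖ * u x) * (‖x‖ * u x) := by
  -- At `n = 0` the tolerance is `⊤`, which is harmless.
  have hε : ∀ n : ℕ, ((n : ℝ≥0∞))⁻¹ ≠ 0 := fun n => by simp
  choose w hw hws w1 w2 w3 using fun n : ℕ => h.exists_smooth_approx hu hxu hH (hε n)
  have sq0 : ∀ {a : ℕ → ℝ≥0∞}, (∀ n, a n ≤ (n : ℝ≥0∞)⁻¹) → Tendsto a atTop (𝓝 0) := fun ha =>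
    tendsto_of_tendsto_of_tendsto_of_le_of_le tendsto_const_nhds
      ENNReal.tendsto_inv_nat_nhds_zero (fun _ => zero_le) ha
  have t1 := sq0 w1
  have t2 := sq0 w2
  have t3 := fun i => sq0 fun n => w3 n i
  have hdc : ∀ n i, Continuous fun x => fderiv ℝ (w n) x (EuclideanSpace.single i 1) := fun n i =>
    ((hw n).continuous_fderiv (by simp)).clm_apply continuous_const
  have m1 : ∀ n, MemLp (w n) 2 volume := fun n =>
    (hw n).continuous.memLp_of_hasCompactSupport (hws n)
  have m2 : ∀ n, MemLp (fun x => ‖x‖ * w n x) 2 volume := fun n =>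
    (continuous_norm.mul (hw n).continuous).memLp_of_hasCompactSupport (hws n).mul_left
  have m3 : ∀ n i, MemLp (fun x => fderiv ℝ (w n) x (EuclideanSpace.single i 1)) 2 volume :=
    fun n i => (hdc n i).memLp_of_hasCompactSupport ((hws n).fderiv_apply (𝕜 := ℝ) _)
  have hpc : ∀ i, Continuous fun x : E => x i := fun i =>
    (EuclideanSpace.proj (𝕜 := ℝ) i).continuous
  have m4 : ∀ n i, MemLp (fun x => x i * w n x) 2 volume := fun n i =>
    ((hpc i).mul (hw n).continuous).memLp_of_hasCompactSupport (hws n).mul_left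
  have m5 : ∀ i, MemLp (fun x => x i * u x) 2 volume := fun i =>
    hxu.of_le ((hpc i).aestronglyMeasurable.mul hu.1) (Eventually.of_forall fun x => norm_coord_mul_le i x _)
  have t4 : ∀ i, Tendsto (fun n => eLpNorm (fun x => x i * w n x - x i * u x) 2 volume) atTop
      (𝓝 0) := fun i => sq0 fun n => by
    refine le_trans (eLpNorm_mono fun x => ?_) (w2 n)
    rw [← mul_sub]; exact norm_coord_mul_le i x _
  have t2' : Tendsto (fun n => eLpNorm (fun x => ‖x‖ * w n x - ‖x‖ * u x) 2 volume) atTop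
      (𝓝 0) := by simpa only [mul_sub] using t2
  have lm := tendsto_integral_mul_of_tendsto_eLpNorm_two m1 m1 hu hu t1 t1
  have lM := tendsto_integral_mul_of_tendsto_eLpNorm_two m2 m2 hxu hxu t2' t2'
  have lJ := fun i => tendsto_integral_mul_of_tendsto_eLpNorm_two (fun n => m3 n i)
    (fun n => m3 n i) (hH.euclidean_apply i) (hH.euclidean_apply i) (t3 i) (t3 i)
  have lx := fun i => tendsto_integral_mul_of_tendsto_eLpNorm_two (fun n => m4 n i)
    (fun n => m3 n i) (m5 i) (hH.euclidean_apply i) (t4 i) (t3 i)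
  rw [hnorm] at lm
  refine ⟨fun i => ?_, ?_⟩
  · have l1 := lm.const_mul (-(1 / 2) : ℝ)
    simp only [← integral_mul_coord_fderiv (hw _) (hws _) i] at l1
    rw [mul_one] at l1
    exact tendsto_nhds_unique (lx i) l1
  obtain ⟨ns, hns, hae⟩ := (tendstoInMeasure_of_tendsto_eLpNorm (p := 2) (by norm_num)
    (fun n => (m1 n).1) hu.1 t1).exists_seq_tendsto_ae
  set g : E → ℝ := fun x => Real.exp (-(c + ‖x‖ ^ 2 / 2)) with hg
  have hgi : Integrable g := integrable_exp_neg_half_sq_norm d c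
  have fatou : ∀ b : ℝ, 0 < b →
      Integrable (fun x => u x ^ 2 * (Real.log (u x ^ 2) + (c + ‖x‖ ^ 2 / 2)) + g x) ∧
      ∫ x, (u x ^ 2 * (Real.log (u x ^ 2) + (c + ‖x‖ ^ 2 / 2)) + g x) ≤
      b ^ 2 * (∑ i, ∫ x, H x i * H x i) + 1 * Real.log 1
        - d * (1 + Real.log b + Real.log Real.pi / 2) * 1
        + c * 1 + 1 / 2 * (∫ x, (‖x‖ * u x) * (‖x‖ * u x)) + ∫ x, g x := by
    intro b hb
    have hk := fun n => integral_relative_entropy_le (hw n) (hws n) c hb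
    refine integrable_and_integral_le_of_tendsto_ae
      (F := fun n x => w (ns n) x ^ 2 * (Real.log (w (ns n) x ^ 2) + (c + ‖x‖ ^ 2 / 2)) + g x)
      (a := fun n => b ^ 2 * (∑ i, ∫ x, fderiv ℝ (w (ns n)) x (EuclideanSpace.single i 1) *
          fderiv ℝ (w (ns n)) x (EuclideanSpace.single i 1))
        + (∫ x, w (ns n) x * w (ns n) x) * Real.log (∫ x, w (ns n) x * w (ns n) x)
        - d * (1 + Real.log b + Real.log Real.pi / 2) * (∫ x, w (ns n) x * w (ns n) x)
        + c * (∫ x, w (ns n) x * w (ns n) x)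
        + 1 / 2 * (∫ x, (‖x‖ * w (ns n) x) * (‖x‖ * w (ns n) x)) + ∫ x, g x)
      (fun n => (hk (ns n)).1.add hgi) (fun n x => mul_log_add_ge _ (sq_nonneg _))
      (fun x => mul_log_add_ge _ (sq_nonneg _)) ?_ (fun n => ?_) ?_
    · filter_upwards [hae] with x hx
      -- Continuity at `t = 0` uses the value `0 * log 0 = 0`.
      have hcont : Continuous fun t : ℝ => t ^ 2 * (Real.log (t ^ 2) + (c + ‖x‖ ^ 2 / 2)) + g x := by
        have : Continuous fun t : ℝ => t ^ 2 * Real.log (t ^ 2) :=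
          Real.continuous_mul_log.comp (continuous_pow 2)
        simp only [mul_add (_ ^ 2)]
        fun_prop
      exact (hcont.tendsto (u x)).comp hx
    · rw [integral_add (hk (ns n)).1 hgi]
      linarith [(hk (ns n)).2]
    · have hnsT := hns.tendsto_atTop
      have lm' := lm.comp hnsT
      have lM' := lM.comp hnsT
      have lJ' := tendsto_finsetSum Finset.univ fun i _ => (lJ i).comp hnsT
      have llog := (Real.continuous_mul_log.tendsto 1).comp lm'
      exact (((((lJ'.const_mul (b ^ 2)).add llog).sub (lm'.const_mul _)).add
        (lm'.const_mul c)).add (lM'.const_mul (1 / 2))).add_const _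
  have hi : Integrable (fun x => u x ^ 2 * (Real.log (u x ^ 2) + (c + ‖x‖ ^ 2 / 2))) := by
    have := (fatou 1 one_pos).1.sub hgi
    refine this.congr (Eventually.of_forall fun x => ?_)
    simp
  refine ⟨hi, fun b hb => ?_⟩
  have := (fatou b hb).2
  rw [integral_add hi hgi] at this
  simp only [Real.log_one, mul_zero, add_zero, mul_one] at this
  linarith

end Limit

/-! ### From Lebesgue to Gaussian measure. -/

section GaussianWeight

variable {d : ℕ}

local notation "E" => EuclideanSpace ℝ (Fin d)

theorem gaussianDensity_eq_exp (x : E) :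
    gaussianDensity d x = Real.exp (-((d : ℝ) / 2 * Real.log (2 * Real.pi) + ‖x‖ ^ 2 / 2)) := by
  unfold gaussianDensity
  rw [Real.rpow_def_of_pos (by positivity), ← Real.exp_add]
  ring_nf

theorem measurable_ofReal_gaussianDensity :
    Measurable fun x : E => ENNReal.ofReal (gaussianDensity d x) := by
  simp only [gaussianDensity_eq_exp]
  exact (by fun_prop : Continuous fun x : E =>
    Real.exp (-((d : ℝ) / 2 * Real.log (2 * Real.pi) + ‖x‖ ^ 2 / 2))).measurable.ennreal_ofReal

theorem integral_gaussianMeasure (F : E → ℝ) :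
    ∫ x, F x ∂gaussianMeasure d = ∫ x, gaussianDensity d x * F x := by
  unfold gaussianMeasure
  rw [integral_withDensity_eq_integral_toReal_smul measurable_ofReal_gaussianDensity (by simp)]
  refine integral_congr_ae (Eventually.of_forall fun x => ?_)
  simp only [smul_eq_mul]
  rw [ENNReal.toReal_ofReal (by rw [gaussianDensity_eq_exp]; positivity)]

theorem integrable_gaussianMeasure_iff (F : E → ℝ) :
    Integrable F (gaussianMeasure d) ↔ Integrable (fun x => gaussianDensity d x * F x) := by
  unfold gaussianMeasure
  rw [integrable_withDensity_iff_integrable_smul' measurable_ofReal_gaussianDensity (by simp)]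
  refine integrable_congr (Eventually.of_forall fun x => ?_)
  simp only [smul_eq_mul]
  rw [ENNReal.toReal_ofReal (by rw [gaussianDensity_eq_exp]; positivity)]

/-- The square root of the Gaussian density. -/
noncomputable def sqrtGaussian (d : ℕ) (x : EuclideanSpace ℝ (Fin d)) : ℝ :=
  Real.exp (-((d : ℝ) / 4 * Real.log (2 * Real.pi) + ‖x‖ ^ 2 / 4))

theorem sqrtGaussian_sq (x : E) : sqrtGaussian d x ^ 2 = gaussianDensity d x := by
  rw [gaussianDensity_eq_exp, sqrtGaussian, ← Real.exp_nat_mul]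
  push_cast; ring_nf

theorem contDiff_sqrtGaussian : ContDiff ℝ ∞ (sqrtGaussian d) :=
  ((contDiff_const.add ((contDiff_norm_sq ℝ).div_const 4)).neg).exp

theorem fderiv_sqrtGaussian (x : E) (i : Fin d) :
    fderiv ℝ (sqrtGaussian d) x (EuclideanSpace.single i 1) = -(1 / 2) * sqrtGaussian d x * x i := by
  have h1 : HasFDerivAt (fun x : E => ‖x‖ ^ 2) (2 • innerSL ℝ x) x :=
    (hasStrictFDerivAt_norm_sq x).hasFDerivAt
  have h2 : HasFDerivAt (sqrtGaussian d) _ x :=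
    (((h1.mul_const (1 / 4 : ℝ)).const_add ((d : ℝ) / 4 * Real.log (2 * Real.pi))).neg).exp
      |>.congr_of_eventuallyEq
      (Eventually.of_forall fun y => by simp only [sqrtGaussian, Pi.neg_apply]; ring_nf)
  rw [h2.fderiv]
  simp [sqrtGaussian, EuclideanSpace.inner_single_right]
  ring_nf

/-- The remaining scalar argument: the stated `b` optimizes the bound in the extremal case `J =
(d/4) exp(2t/d)`, where `b² = d/(2J)`, and it turns the bound into `J ≥ (d/4) exp(2t/d)`. -/
theorem deficit_le_of_bound (d : ℕ) (hd : 1 ≤ d) {Ent M I J : ℝ} (hJ : J = I + d / 2 - M / 4)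
    (hb : ∀ b : ℝ, 0 < b → Ent ≤ b ^ 2 * J - d * (1 + Real.log b + Real.log Real.pi / 2)
      + d / 2 * Real.log (2 * Real.pi) + 1 / 2 * M) :
    deficitProfile d (Ent + d / 2 - 1 / 2 * M) ≤ I - 1 / 2 * Ent := by
  have hd0 : (0 : ℝ) < d := by exact_mod_cast hd
  set t := Ent + d / 2 - 1 / 2 * M with ht
  have h := hb (Real.sqrt 2 * Real.exp (-(t / d))) (by positivity)
  rw [Real.log_mul (by positivity) (Real.exp_pos _).ne', Real.log_exp, Real.log_sqrt (by norm_num),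
    mul_pow, Real.sq_sqrt (by norm_num), ← Real.exp_nat_mul,
    Real.log_mul (by norm_num) Real.pi_pos.ne'] at h
  have e1 : ((2 : ℕ) : ℝ) * -(t / d) = -(2 * t / d) := by push_cast; ring
  have e2 : (d : ℝ) * (1 + (Real.log 2 / 2 + -(t / d)) + Real.log Real.pi / 2)
      = d + d / 2 * Real.log 2 - t + d / 2 * Real.log Real.pi := by
    field_simp; ring
  rw [e1, e2] at h
  have h2 : (d : ℝ) / 4 ≤ Real.exp (-(2 * t / d)) * J := by linarith
  have h3 := mul_le_mul_of_nonneg_left h2 (Real.exp_pos (2 * t / d)).le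
  rw [← mul_assoc, ← Real.exp_add, add_neg_cancel, Real.exp_zero, one_mul] at h3
  unfold deficitProfile
  have e3 : (d : ℝ) / 4 * (Real.exp (2 * t / d) - 1 - 2 * t / d)
      = Real.exp (2 * t / d) * (d / 4) - d / 4 - t / 2 := by
    field_simp; ring
  rw [e3]
  linarith

end GaussianWeight

theorem lemma2p5 (d : ℕ) (hd : 1 ≤ d)
    (v : EuclideanSpace ℝ (Fin d) → ℝ)
    (G : EuclideanSpace ℝ (Fin d) → EuclideanSpace ℝ (Fin d))
    (hv : IsGaussianH1 v G)
    (hnorm : ∫ x, |v x| ^ 2 ∂(gaussianMeasure d) = 1)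
    (hmoment : Integrable (fun x => ‖x‖ ^ 2 * |v x| ^ 2) (gaussianMeasure d)) :
    Integrable (fun x => |v x| ^ 2 * Real.log (|v x| ^ 2)) (gaussianMeasure d) ∧
    deficitProfile d
        ((∫ x, |v x| ^ 2 * Real.log (|v x| ^ 2) ∂(gaussianMeasure d)) + (d : ℝ) / 2
          - 1 / 2 * ∫ x, ‖x‖ ^ 2 * |v x| ^ 2 ∂(gaussianMeasure d))
      ≤ (∫ x, ‖G x‖ ^ 2 ∂(gaussianMeasure d))
          - 1 / 2 * ∫ x, |v x| ^ 2 * Real.log (|v x| ^ 2) ∂(gaussianMeasure d) := by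
  set η := sqrtGaussian d with hη
  have hηs : ContDiff ℝ ∞ η := contDiff_sqrtGaussian
  have hη0 : ∀ x, 0 < η x := fun x => Real.exp_pos _
  set D : EuclideanSpace ℝ (Fin d) → EuclideanSpace ℝ (Fin d) :=
    fun x => (-(1 / 2) * η x) • x with hD
  have hDc : Continuous D := (continuous_const.mul hηs.continuous).smul continuous_id
  set u : EuclideanSpace ℝ (Fin d) → ℝ := fun x => η x * v x with hu
  set H : EuclideanSpace ℝ (Fin d) → EuclideanSpace ℝ (Fin d) :=
    fun x => η x • G x + v x • D x with hH
  have hw : IsWeakGradient u H := hv.isWeakGradient.mul_smooth hηs hDc fun x i => by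
    rw [fderiv_sqrtGaussian]; simp [hD, hη]
  have hsq : ∀ x, gaussianDensity d x = η x ^ 2 := fun x => (sqrtGaussian_sq x).symm
  have hG : LocallyIntegrable G volume := hv.isWeakGradient.locallyIntegrable_grad
  have mu : MemLp u 2 volume := by
    refine (memLp_two_iff_integrable_sq hw.locallyIntegrable.aestronglyMeasurable).2 ?_
    have := (integrable_gaussianMeasure_iff _).1 hv.memLp.integrable_sq
    refine this.congr (Eventually.of_forall fun x => ?_)
    simp only [hu, hsq, mul_pow]
  have mxu : MemLp (fun x => ‖x‖ * u x) 2 volume := by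
    refine (memLp_two_iff_integrable_sq (continuous_norm.aestronglyMeasurable.mul mu.1)).2 ?_
    refine ((integrable_gaussianMeasure_iff _).1 hmoment).congr (Eventually.of_forall fun x => ?_)
    simp only [hu, hsq, sq_abs, Pi.mul_apply]; ring
  have mG : MemLp (fun x => η x • G x) 2 volume := by
    refine (memLp_two_iff_integrable_sq_norm
      (hηs.continuous.aestronglyMeasurable.smul hG.aestronglyMeasurable)).2 ?_
    have h1 := (memLp_two_iff_integrable_sq_norm hv.memLp_grad.1).1 hv.memLp_grad
    refine ((integrable_gaussianMeasure_iff _).1 h1).congr (Eventually.of_forall fun x => ?_)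
    simp only [hsq, Pi.smul_apply', norm_smul, mul_pow, Real.norm_eq_abs, sq_abs]
  have mD : MemLp (fun x => v x • D x) 2 volume := by
    refine mxu.of_le (hv.isWeakGradient.locallyIntegrable.smul_continuous hDc).aestronglyMeasurable
      (Eventually.of_forall fun x => ?_)
    simp only [hD, hu, norm_smul, norm_mul, norm_norm]
    norm_num
    nlinarith [mul_nonneg (mul_nonneg (norm_nonneg x) (abs_nonneg (η x))) (abs_nonneg (v x))]
  have mH : MemLp H 2 volume := mG.add mD
  have hu1 : ∫ x, u x * u x = 1 := by
    rw [← hnorm, integral_gaussianMeasure]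
    congr 1; ext x
    simp only [hu, hsq, sq_abs]; ring
  obtain ⟨hcross, hent, hbound⟩ := hw.relative_entropy_le mu mxu mH hu1
    ((d : ℝ) / 2 * Real.log (2 * Real.pi))
  -- The added quadratic is `-log γ`, so the right side is `u² log (u²/γ)`; points with `v = 0` are
  -- separate because `log` does not split there.
  have hentv : ∀ x, gaussianDensity d x * (|v x| ^ 2 * Real.log (|v x| ^ 2))
      = u x ^ 2 * (Real.log (u x ^ 2) + ((d : ℝ) / 2 * Real.log (2 * Real.pi) + ‖x‖ ^ 2 / 2)) := by
    intro x
    by_cases h0 : v x = 0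
    · simp [hu, h0]
    · have h1 : u x ^ 2 = gaussianDensity d x * v x ^ 2 := by simp only [hu, hsq, mul_pow]
      have h2 : gaussianDensity d x ≠ 0 := by rw [hsq]; exact (pow_pos (hη0 x) 2).ne'
      rw [h1, Real.log_mul h2 (pow_ne_zero 2 h0), sq_abs]
      nth_rw 3 [gaussianDensity_eq_exp]
      rw [Real.log_exp]; ring
  refine ⟨(integrable_gaussianMeasure_iff _).2 ?_, ?_⟩
  · simpa only [hentv] using hent
  have eM : ∫ x, ‖x‖ ^ 2 * |v x| ^ 2 ∂gaussianMeasure d = ∫ x, (‖x‖ * u x) * (‖x‖ * u x) := by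
    rw [integral_gaussianMeasure]
    congr 1; ext x
    simp only [hu, hsq, sq_abs]; ring
  have iM : Integrable fun x => (‖x‖ * u x) * (‖x‖ * u x) := mxu.integrable_mul mxu
  have iJ : ∀ i, Integrable fun x => H x i * H x i := fun i =>
    (mH.euclidean_apply i).integrable_mul (mH.euclidean_apply i)
  have mxi : ∀ i, MemLp (fun x : EuclideanSpace ℝ (Fin d) => x i * u x) 2 volume := fun i =>
    mxu.of_le ((EuclideanSpace.proj (𝕜 := ℝ) i).continuous.aestronglyMeasurable.mul mu.1)
      (Eventually.of_forall fun x => norm_coord_mul_le i x _)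
  have iC : ∀ i, Integrable fun x => (x i * u x) * H x i := fun i =>
    (mxi i).integrable_mul (mH.euclidean_apply i)
  have eI : ∫ x, ‖G x‖ ^ 2 ∂gaussianMeasure d
      = (∑ i, ∫ x, H x i * H x i) - d / 2 + 1 / 4 * ∫ x, (‖x‖ * u x) * (‖x‖ * u x) := by
    -- Expand the square of `√γ G = H + u x / 2`, which follows from `∇√γ = -√γ x / 2`.
    have h1 : ∀ x, gaussianDensity d x * ‖G x‖ ^ 2
        = (∑ i, H x i * H x i) + (∑ i, (x i * u x) * H x i)
          + 1 / 4 * ((‖x‖ * u x) * (‖x‖ * u x)) := by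
      intro x
      have h2 : (‖x‖ * u x) * (‖x‖ * u x) = ∑ i, (x i * u x) ^ 2 := by
        have : ‖x‖ ^ 2 = ∑ i, x i ^ 2 := by simp [EuclideanSpace.norm_sq_eq]
        rw [show (‖x‖ * u x) * (‖x‖ * u x) = ‖x‖ ^ 2 * u x ^ 2 by ring, this, Finset.sum_mul]
        simp only [mul_pow]
      rw [h2, EuclideanSpace.norm_sq_eq, Finset.mul_sum, Finset.mul_sum, ← Finset.sum_add_distrib,
        ← Finset.sum_add_distrib]
      refine Finset.sum_congr rfl fun i _ => ?_
      simp only [hH, hD, hu, hsq, PiLp.add_apply, PiLp.smul_apply, smul_eq_mul, Real.norm_eq_abs,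
        sq_abs]
      ring
    have s1 : Integrable fun x => ∑ i, H x i * H x i := integrable_finsetSum _ fun i _ => iJ i
    have s2 : Integrable fun x => ∑ i, (x i * u x) * H x i := integrable_finsetSum _ fun i _ => iC i
    have s3 : Integrable fun x => (∑ i, H x i * H x i) + ∑ i, (x i * u x) * H x i := s1.add s2
    rw [integral_gaussianMeasure]
    simp only [h1]
    rw [integral_add s3 (iM.const_mul _), integral_add s1 s2, integral_const_mul,
      integral_finsetSum _ fun i _ => iJ i, integral_finsetSum _ fun i _ => iC i]
    simp only [hcross, Finset.sum_const, Finset.card_univ, Fintype.card_fin, nsmul_eq_mul]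
    ring
  have eE : ∫ x, |v x| ^ 2 * Real.log (|v x| ^ 2) ∂gaussianMeasure d
      = ∫ x, u x ^ 2 * (Real.log (u x ^ 2)
          + ((d : ℝ) / 2 * Real.log (2 * Real.pi) + ‖x‖ ^ 2 / 2)) := by
    rw [integral_gaussianMeasure]
    simp only [hentv]
  refine deficit_le_of_bound d hd (J := ∑ i, ∫ x, H x i * H x i) ?_ fun b hb => ?_
  · rw [eI, eM]; ring
  · rw [eE, eM]; exact hbound b hb
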